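/- There is an absolute constant $C>0$ such that for every integer $q \ge 1$ and every residue class $a$ modulo $q$ coprime to $q$, the limit $$\mathcal{L}_{q,a} = \lim_{\substack{s \to 1\\ \mathrm{Re}(s) > 1}} \left( \sum_{p \equiv a \ (\mathrm{mod}\ q)} \frac{1}{p^{s}} - \frac{1}{\varphi(q)} \log\left(\frac{1}{s-1}\right) \right)$$ exists, where $s$ is complex, the sum is over primes $p$, $\varphi$ is Euler's totient function and $\log$ is the principal branch of the logarithm, and $$\left| \mathcal{L}_{q,a} - \frac{1}{p_{q,a}} \right| \le C\, \frac{\log(2q)}{\varphi(q)},$$ where $p_{q,a}$ is the least prime congruent to $a$ modulo $q$. -/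

import Mathlib

open Filter Topology

/-- The set of primes `p ≡ a (mod q)`, for a residue class `a` modulo `q`. -/
def primesInClass {q : ℕ} (a : ZMod q) : Set ℕ :=
  {p : ℕ | p.Prime ∧ (p : ZMod q) = a}

/-- The least prime `p ≡ a (mod q)`; see `isLeast_leastPrimeInClass`. -/
noncomputable def leastPrimeInClass {q : ℕ} (a : ZMod q) : ℕ :=
  sInf (primesInClass a)

/-- The Dirichlet series `∑_{p ≡ a (mod q)} p^{-s}` over primes, used for `Re s > 1`, where it
converges absolutely; see `summable_primeClassSeries`. -/
noncomputable def primeClassSeries {q : ℕ} (a : ZMod q) (s : ℂ) : ℂ :=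
  ∑' p : primesInClass a, 1 / ((p : ℕ) : ℂ) ^ s

/-- For a coprime residue class the least prime really exists (Dirichlet). -/
theorem isLeast_leastPrimeInClass {q : ℕ} (hq : 1 ≤ q) {a : ZMod q} (ha : IsUnit a) :
    IsLeast (primesInClass a) (leastPrimeInClass a) := by
  haveI : NeZero q := ⟨by omega⟩
  obtain ⟨p, -, hp, hpa⟩ := Nat.forall_exists_prime_gt_and_eq_mod ha 0
  have hne : (primesInClass a).Nonempty := ⟨p, hp, hpa⟩
  exact ⟨Nat.sInf_mem hne, fun m hm => Nat.sInf_le hm⟩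

/-- The series defining `primeClassSeries a s` converges absolutely for `Re s > 1`. -/
theorem summable_primeClassSeries {q : ℕ} (a : ZMod q) {s : ℂ} (hs : 1 < s.re) :
    Summable (fun p : primesInClass a => 1 / ((p : ℕ) : ℂ) ^ s) :=
  (Complex.summable_one_div_nat_cpow.mpr hs).subtype (primesInClass a)

/-! Cut the primes at `y = 2 ^ J` with `J = (2 * q) ^ 6`: characters handle the primes above `y`, a
sieve those below. Let `Sa` and `S1` be the sums of `1/p` over `p < y`, in the class and over all
primes, and let `L₁` be the limit constant for `q = 1`.

Above `y`, orthogonality writes `L - Sa - (L₁ - S1)/φ(q)` as a mean, over the nontrivial characters,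
of tails of `∑ χ(p)/p^σ` as `σ → 1`. Mertens' argument bounds `|L(1,χ)| * |∑ χ(n)Λ(n)/n|` by `8q`,
and `|L(1,χ)| ≥ c q^(-4)`; so the tails are `O(q^5 / log y)` uniformly in `σ > 1`
(`exists_norm_sum_prime_le`). As `log y` has order `q^6`, the error is `O(1/q)`. The lower bound for
`L(1,χ)` comes from a Lambert series when `χ^2 = 1` and from the 3-4-1 inequality otherwise.

Below `y`, every prime of the class other than the least one exceeds `q`. Selberg's sieve gives a
Brun–Titchmarsh bound, and dyadic summation makes these primes contribute `O((log 2q + log J)/φ(q))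
= O(log 2q / φ(q))` (`exists_sum_inv_primes_le`). With `q = 1` the same bound gives `S1 = O(log
2q)`.

The limit exists because the function has bounded derivative near `1` in `Re s > 1`. -/

/-! ### Abel summation and character sums near `s = 1`. -/

/-- **Abel summation**: an oscillating sum with decreasing nonnegative weights. -/
theorem norm_sum_Ico_mul_le {c : ℕ → ℂ} {M : ℝ} (hM : ∀ m n, ‖∑ i ∈ Finset.Ico m n, c i‖ ≤ M)
    {f : ℕ → ℝ} {m : ℕ} (hf : ∀ i, m ≤ i → f (i + 1) ≤ f i) (hf0 : ∀ i, m ≤ i → 0 ≤ f i) (n : ℕ) :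
    ‖∑ i ∈ Finset.Ico m n, (f i : ℂ) * c i‖ ≤ f m * M := by
  have hM0 : 0 ≤ M := (norm_nonneg _).trans (hM 0 0)
  rcases le_total n m with h | h
  · rw [Finset.Ico_eq_empty_of_le h]
    simpa using mul_nonneg (hf0 m le_rfl) hM0
  have key : ∀ n, m ≤ n → ‖∑ i ∈ Finset.Ico m n, (f i : ℂ) * c i
      - f n * ∑ i ∈ Finset.Ico m n, c i‖ ≤ (f m - f n) * M := by
    intro n hn
    induction n, hn using Nat.le_induction with
    | base => simp
    | succ n hn ih =>
      have e : ∑ i ∈ Finset.Ico m (n + 1), (f i : ℂ) * c i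
          - f (n + 1) * ∑ i ∈ Finset.Ico m (n + 1), c i
          = (∑ i ∈ Finset.Ico m n, (f i : ℂ) * c i - f n * ∑ i ∈ Finset.Ico m n, c i)
          + ((f n - f (n + 1) : ℝ) : ℂ) * ∑ i ∈ Finset.Ico m (n + 1), c i := by
        rw [Finset.sum_Ico_succ_top hn, Finset.sum_Ico_succ_top hn]
        push_cast
        ring
      rw [e]
      refine (norm_add_le _ _).trans ?_
      have h2 : ‖((f n - f (n + 1) : ℝ) : ℂ) * ∑ i ∈ Finset.Ico m (n + 1), c i‖
          ≤ (f n - f (n + 1)) * M := by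
        rw [norm_mul, Complex.norm_of_nonneg (sub_nonneg.2 (hf n hn))]
        exact mul_le_mul_of_nonneg_left (hM _ _) (sub_nonneg.2 (hf n hn))
      linarith
  have h1 := key n h
  have h2 : ‖(f n : ℂ) * ∑ i ∈ Finset.Ico m n, c i‖ ≤ f n * M := by
    rw [norm_mul, Complex.norm_of_nonneg (hf0 n h)]
    exact mul_le_mul_of_nonneg_left (hM _ _) (hf0 n h)
  have h3 := norm_add_le (∑ i ∈ Finset.Ico m n, (f i : ℂ) * c i
      - f n * ∑ i ∈ Finset.Ico m n, c i) (f n * ∑ i ∈ Finset.Ico m n, c i)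
  rw [sub_add_cancel] at h3
  linarith

namespace DirichletCharacter

variable {q : ℕ} [NeZero q] {χ : DirichletCharacter ℂ q}

theorem sum_Ico_period_eq_zero (hχ : χ ≠ 1) (a : ℕ) :
    ∑ n ∈ Finset.Ico a (a + q), χ (n : ZMod q) = 0 := by
  rw [← MulChar.sum_eq_zero_of_ne_one hχ]
  refine Finset.sum_bij (fun n _ => (n : ZMod q)) (fun _ _ => Finset.mem_univ _) ?_ ?_
    (fun _ _ => rfl)
  · intro m hm n hn h
    simp only [Finset.mem_Ico] at hm hn
    have h' : m ≡ n [MOD q] := (ZMod.natCast_eq_natCast_iff _ _ _).1 h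
    rcases le_total m n with hmn | hmn
    · have := (Nat.modEq_iff_dvd' hmn).1 h'
      have := Nat.eq_zero_of_dvd_of_lt this (by omega)
      omega
    · have := (Nat.modEq_iff_dvd' hmn).1 h'.symm
      have := Nat.eq_zero_of_dvd_of_lt this (by omega)
      omega
  · intro b _
    have hq := NeZero.pos q
    refine ⟨a + (b - (a : ZMod q)).val, ?_, ?_⟩
    · have := ZMod.val_lt (b - (a : ZMod q))
      simp only [Finset.mem_Ico]
      omega
    · push_cast
      rw [ZMod.natCast_zmod_val]
      ring

theorem norm_sum_Ico_le (hχ : χ ≠ 1) (a b : ℕ) :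
    ‖∑ n ∈ Finset.Ico a b, χ (n : ZMod q)‖ ≤ q := by
  have hq := NeZero.pos q
  induction h : b - a using Nat.strong_induction_on generalizing a with
  | _ k ih =>
    rcases lt_or_ge k q with hk | hk
    · refine (norm_sum_le_of_le _ (fun n _ => χ.norm_le_one _)).trans ?_
      simp only [Finset.sum_const, Nat.card_Ico, nsmul_eq_mul, mul_one]
      exact_mod_cast (by omega : b - a ≤ q)
    · rw [← Finset.sum_Ico_consecutive _ (by omega : a ≤ a + q) (by omega : a + q ≤ b),
        sum_Ico_period_eq_zero hχ, zero_add]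
      exact ih (b - (a + q)) (by omega) (a + q) rfl

theorem norm_sum_Ico_inv_mul_le (hχ : χ ≠ 1) {a : ℕ} (ha : 1 ≤ a) (b : ℕ) :
    ‖∑ n ∈ Finset.Ico a b, χ (n : ZMod q) / (n : ℂ)‖ ≤ q / a := by
  have h := norm_sum_Ico_mul_le (c := fun n => χ (n : ZMod q)) (norm_sum_Ico_le hχ)
    (f := fun n => 1 / (n : ℝ)) (m := a)
    (fun i hi => by
      have : (0 : ℝ) < i := by exact_mod_cast (by omega : 0 < i)
      push_cast
      gcongr
      linarith) (fun i _ => by positivity) b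
  refine le_of_eq_of_le ?_ (h.trans_eq (by ring))
  congr 1
  refine Finset.sum_congr rfl fun n _ => ?_
  push_cast
  ring

/-- The conditionally convergent series `∑ χ(n)/n`. -/
theorem exists_tendsto_sum_div (hχ : χ ≠ 1) : ∃ l : ℂ,
    Tendsto (fun N : ℕ => ∑ n ∈ Finset.Ico 1 N, χ (n : ZMod q) / (n : ℂ)) atTop (𝓝 l) := by
  refine cauchySeq_tendsto_of_complete ?_
  refine Metric.cauchySeq_iff'.2 fun ε hε => ?_
  obtain ⟨N, hN⟩ := exists_nat_gt (q / ε)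
  refine ⟨N + 1, fun n hn => ?_⟩
  rw [dist_eq_norm, ← Finset.sum_Ico_consecutive _ (by omega : 1 ≤ N + 1) hn, add_sub_cancel_left]
  refine (norm_sum_Ico_inv_mul_le hχ (by omega) n).trans_lt ?_
  rw [div_lt_iff₀ (by positivity)]
  rw [div_lt_iff₀ hε] at hN
  push_cast
  nlinarith

theorem norm_sub_sum_div_le (hχ : χ ≠ 1) {l : ℂ}
    (hl : Tendsto (fun N : ℕ => ∑ n ∈ Finset.Ico 1 N, χ (n : ZMod q) / (n : ℂ)) atTop (𝓝 l))
    {a : ℕ} (ha : 1 ≤ a) :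
    ‖l - ∑ n ∈ Finset.Ico 1 a, χ (n : ZMod q) / (n : ℂ)‖ ≤ q / a := by
  refine le_of_tendsto ((hl.sub_const _).norm) ?_
  filter_upwards [eventually_ge_atTop a] with N hN
  rw [← Finset.sum_Ico_consecutive _ ha hN, add_sub_cancel_left]
  exact norm_sum_Ico_inv_mul_le hχ ha N

/-- Abel summation applies from `n = 3` on, where `log n / n` decreases because `e < 3`. Of the
earlier terms only `n = 2` is nonzero, and it costs at most `1 ≤ q`. -/
theorem norm_sum_Ico_log_le (hχ : χ ≠ 1) (a b : ℕ) :
    ‖∑ n ∈ Finset.Ico a b, χ (n : ZMod q) * (Real.log n / n : ℝ)‖ ≤ 2 * q := by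
  have hq : (1 : ℝ) ≤ q := by exact_mod_cast NeZero.pos q
  have large : ∀ a b : ℕ, 3 ≤ a →
      ‖∑ n ∈ Finset.Ico a b, χ (n : ZMod q) * (Real.log n / n : ℝ)‖ ≤ q := by
    intro a b ha
    have h := norm_sum_Ico_mul_le (c := fun n => χ (n : ZMod q)) (norm_sum_Ico_le hχ)
      (f := fun n => Real.log n / n) (m := a)
      (fun i hi => by
        have h3 : (3 : ℝ) ≤ i := by exact_mod_cast (by omega : 3 ≤ i)
        have := Real.exp_one_lt_d9
        exact Real.log_div_self_antitoneOn (Set.mem_Ici.2 (by linarith))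
          (Set.mem_Ici.2 (by push_cast; linarith)) (by push_cast; linarith))
      (fun i _ => by positivity) b
    have h1 : Real.log a / a ≤ 1 := by
      refine div_le_one_of_le₀ ?_ (by positivity)
      exact (Real.log_le_sub_one_of_pos (by exact_mod_cast (by omega : 0 < a))).trans (by linarith)
    have h2 : Real.log a / a * q ≤ q := mul_le_of_le_one_left (by linarith) h1
    simp_rw [mul_comm (χ _)]
    exact h.trans h2
  rcases le_or_gt 3 a with ha | ha
  · linarith [large a b ha]
  rcases le_or_gt b 3 with hb | hb
  · have : ∀ n ∈ Finset.Ico a b, n ≠ 2 → χ (n : ZMod q) * (Real.log n / n : ℝ) = 0 := by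
      intro n hn h2
      simp only [Finset.mem_Ico] at hn
      have : n = 0 ∨ n = 1 := by omega
      rcases this with rfl | rfl <;> simp
    have h2 : ‖χ ((2 : ℕ) : ZMod q) * (Real.log (2 : ℕ) / (2 : ℕ) : ℝ)‖ ≤ 1 := by
      rw [norm_mul]
      refine mul_le_one₀ (χ.norm_le_one _) (norm_nonneg _) ?_
      rw [Complex.norm_of_nonneg (by positivity)]
      have := Real.log_two_lt_d9
      push_cast
      linarith
    by_cases hm : 2 ∈ Finset.Ico a b
    · rw [Finset.sum_eq_single_of_mem 2 hm this]
      linarith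
    · rw [Finset.sum_eq_zero fun n hn => this n hn (by rintro rfl; exact hm hn)]
      simp
  · rw [← Finset.sum_Ico_consecutive _ ha.le hb.le]
    refine (norm_add_le _ _).trans ?_
    have h1 := large 3 b le_rfl
    have : ‖∑ n ∈ Finset.Ico a 3, χ (n : ZMod q) * (Real.log n / n : ℝ)‖ ≤ 1 := by
      have h0 : ∀ n ∈ Finset.Ico a 3, n ≠ 2 → χ (n : ZMod q) * (Real.log n / n : ℝ) = 0 := by
        intro n hn h2
        simp only [Finset.mem_Ico] at hn
        have : n = 0 ∨ n = 1 := by omega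
        rcases this with rfl | rfl <;> simp
      rw [Finset.sum_eq_single_of_mem 2 (by simp; omega) h0, norm_mul]
      refine mul_le_one₀ (χ.norm_le_one _) (norm_nonneg _) ?_
      rw [Complex.norm_of_nonneg (by positivity)]
      have := Real.log_two_lt_d9
      push_cast
      linarith
    linarith

end DirichletCharacter

/-- This is the slope of the convex function `exp` between `-u` and `0`. -/
theorem antitoneOn_one_sub_exp_neg_div :
    AntitoneOn (fun u : ℝ => (1 - Real.exp (-u)) / u) (Set.Ioi 0) := by
  intro u hu v hv huv
  simp only [Set.mem_Ioi] at hu hv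
  have h := convexOn_exp.secant_mono (a := 0) (x := -v) (y := -u) (Set.mem_univ _)
    (Set.mem_univ _) (Set.mem_univ _) (by linarith) (by linarith) (by linarith)
  simp only [Real.exp_zero, sub_zero] at h
  have e : ∀ w : ℝ, (Real.exp (-w) - 1) / -w = (1 - Real.exp (-w)) / w := fun w => by
    rw [← neg_div_neg_eq, neg_neg, neg_sub]
  rw [e, e] at h
  exact h

namespace DirichletCharacter

variable {q : ℕ} [NeZero q] {χ : DirichletCharacter ℂ q}

/-- The difference `1/n - 1/n^(1+δ)` is not monotone in `n`, but it equals `log n / n` times `δ (1 -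
e^(-u))/u` with `u = δ log n`. The second factor decreases and is at most `δ`, so Abel summation
against the sums of `χ(n) log n / n` applies. -/
theorem norm_sum_Ico_sub_rpow_le (hχ : χ ≠ 1) {δ : ℝ} (hδ : 0 < δ) (N : ℕ) :
    ‖∑ n ∈ Finset.Ico 1 N, χ (n : ZMod q) * (1 / (n : ℝ) - 1 / (n : ℝ) ^ (1 + δ) : ℝ)‖
      ≤ δ * (2 * q) := by
  have hq : (0 : ℝ) ≤ q := Nat.cast_nonneg q
  rcases le_or_gt N 1 with hN | hN
  · rw [Finset.Ico_eq_empty_of_le hN]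
    simp only [Finset.sum_empty, norm_zero]
    positivity
  rw [Finset.sum_eq_sum_Ico_succ_bot hN]
  simp only [Nat.cast_one, Real.one_rpow, sub_self, Complex.ofReal_zero, mul_zero, zero_add]
  have hlog : ∀ i : ℕ, 2 ≤ i → 0 < Real.log i := fun i hi =>
    Real.log_pos (by exact_mod_cast (by omega : 1 < i))
  set w : ℕ → ℝ := fun n => δ * ((1 - Real.exp (-(δ * Real.log n))) / (δ * Real.log n)) with hw
  have hw0 : ∀ i, 2 ≤ i → 0 ≤ w i := fun i hi => by
    have := hlog i hi
    have h2 : Real.exp (-(δ * Real.log i)) ≤ 1 := by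
      rw [Real.exp_le_one_iff]
      have := mul_pos hδ this
      linarith
    have : 0 ≤ 1 - Real.exp (-(δ * Real.log i)) := by linarith
    positivity
  have h := norm_sum_Ico_mul_le (c := fun n => χ (n : ZMod q) * (Real.log n / n : ℝ))
    (norm_sum_Ico_log_le hχ) (f := w) (m := 2)
    (fun i hi => by
      refine mul_le_mul_of_nonneg_left ?_ hδ.le
      refine antitoneOn_one_sub_exp_neg_div (mul_pos hδ (hlog i hi))
        (mul_pos hδ (hlog (i + 1) (by omega))) ?_
      refine mul_le_mul_of_nonneg_left (Real.log_le_log ?_ ?_) hδ.le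
      · exact_mod_cast (by omega : 0 < i)
      · push_cast; linarith) hw0 N
  have hw2 : w 2 ≤ δ := by
    refine mul_le_of_le_one_right hδ.le ?_
    have h2 := mul_pos hδ (hlog 2 le_rfl)
    rw [div_le_one h2]
    have := Real.add_one_le_exp (-(δ * Real.log (2 : ℕ)))
    linarith
  refine le_of_eq_of_le ?_ (h.trans (mul_le_mul_of_nonneg_right hw2 (by positivity)))
  congr 1
  refine Finset.sum_congr rfl fun n hn => ?_
  simp only [Finset.mem_Ico] at hn
  have hn0 : (0 : ℝ) < n := by exact_mod_cast (by omega : 0 < n)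
  have := hlog n (by omega)
  have e : 1 / (n : ℝ) - 1 / (n : ℝ) ^ (1 + δ) = w n * (Real.log n / n) := by
    rw [hw, Real.rpow_add hn0, Real.rpow_one, Real.rpow_def_of_pos hn0 δ, mul_comm (Real.log _) δ]
    simp only [Real.exp_neg]
    have := Real.exp_pos (δ * Real.log n)
    field_simp
  rw [e]
  push_cast
  ring

theorem norm_sum_Ico_rpow_le (hχ : χ ≠ 1) {σ : ℝ} (hσ : 0 < σ) (N : ℕ) :
    ‖∑ n ∈ Finset.Ico 1 N, χ (n : ZMod q) * (1 / (n : ℝ) ^ σ : ℝ)‖ ≤ q := by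
  have h := norm_sum_Ico_mul_le (c := fun n => χ (n : ZMod q)) (norm_sum_Ico_le hχ)
    (f := fun n => 1 / (n : ℝ) ^ σ) (m := 1)
    (fun i hi => by
      have : (0 : ℝ) < i := by exact_mod_cast (by omega : 0 < i)
      push_cast
      gcongr
      linarith) (fun i _ => by positivity) N
  simp_rw [mul_comm (χ _)]
  simpa using h

omit [NeZero q] in
theorem tendsto_sum_LSeries (χ : DirichletCharacter ℂ q) {σ : ℝ} (hσ : 1 < σ) :
    Tendsto (fun N : ℕ => ∑ n ∈ Finset.Ico 1 N, χ (n : ZMod q) * (1 / (n : ℝ) ^ σ : ℝ)) atTop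
      (𝓝 (LSeries (fun n => χ (n : ZMod q)) σ)) := by
  have h := (LSeriesSummable_of_one_lt_re χ (s := σ) (by simpa using hσ)).hasSum.tendsto_sum_nat
  refine h.congr' ?_
  filter_upwards [eventually_ge_atTop 1] with N hN
  rw [Finset.range_eq_Ico, Finset.sum_eq_sum_Ico_succ_bot (by omega)]
  simp only [LSeries.term_zero, zero_add]
  refine Finset.sum_congr rfl fun n hn => ?_
  simp only [Finset.mem_Ico] at hn
  rw [LSeries.term_of_ne_zero (by omega)]
  push_cast
  rw [Complex.ofReal_cpow (Nat.cast_nonneg n)]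
  simp [div_eq_mul_inv]

theorem norm_LSeries_le (hχ : χ ≠ 1) {σ : ℝ} (hσ : 1 < σ) :
    ‖LSeries (fun n => χ (n : ZMod q)) σ‖ ≤ q :=
  le_of_tendsto (tendsto_sum_LSeries χ hσ).norm
    (Eventually.of_forall fun N => norm_sum_Ico_rpow_le hχ (by linarith) N)

theorem norm_sub_LSeries_le (hχ : χ ≠ 1) {l : ℂ}
    (hl : Tendsto (fun N : ℕ => ∑ n ∈ Finset.Ico 1 N, χ (n : ZMod q) / (n : ℂ)) atTop (𝓝 l))
    {δ : ℝ} (hδ : 0 < δ) :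
    ‖l - LSeries (fun n => χ (n : ZMod q)) (1 + δ : ℝ)‖ ≤ δ * (2 * q) := by
  refine le_of_tendsto (hl.sub (tendsto_sum_LSeries χ (by linarith : 1 < 1 + δ))).norm
    (Eventually.of_forall fun N => ?_)
  refine le_of_eq_of_le ?_ (norm_sum_Ico_sub_rpow_le hχ hδ N)
  rw [← Finset.sum_sub_distrib]
  congr 1
  refine Finset.sum_congr rfl fun n _ => ?_
  push_cast
  ring

end DirichletCharacter

/-! ### Lower bounds for `L(1, χ)`. -/

/-- Pairing the terms `i` and `k - i` by AM–GM bounds a geometric sum of `k + 1` terms below by `(k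
+ 1) s^k`. Multiplying the cases `k = n - 1` and `k = n` gives `s^(2n-1) ≥ s^(2n)`; the base is a
square so that the half-integral power of `t = s^2` needs no root. -/
theorem mul_pow_two_mul_le_geom_sum_mul {s : ℝ} (hs0 : 0 ≤ s) (hs1 : s ≤ 1) (n : ℕ) :
    n * (n + 1) * (s ^ 2) ^ n
      ≤ (∑ i ∈ Finset.range n, (s ^ 2) ^ i) * ∑ i ∈ Finset.range (n + 1), (s ^ 2) ^ i := by
  have key : ∀ k : ℕ, (k + 1 : ℕ) * s ^ k ≤ ∑ i ∈ Finset.range (k + 1), (s ^ 2) ^ i := by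
    intro k
    have h1 : ∑ i ∈ Finset.range (k + 1), (s ^ 2) ^ (k - i)
        = ∑ i ∈ Finset.range (k + 1), (s ^ 2) ^ i := by
      rw [← Finset.sum_range_reflect (fun i => (s ^ 2) ^ i)]
      refine Finset.sum_congr rfl fun i _ => ?_
      congr 1
    have h2 : ∑ i ∈ Finset.range (k + 1), 2 * s ^ k
        ≤ ∑ i ∈ Finset.range (k + 1), ((s ^ 2) ^ i + (s ^ 2) ^ (k - i)) := by
      refine Finset.sum_le_sum fun i hi => ?_
      have hik : i ≤ k := by simpa [Nat.lt_succ_iff] using hi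
      have e : s ^ k = s ^ i * s ^ (k - i) := by rw [← pow_add]; congr 1; omega
      rw [e, ← pow_mul, ← pow_mul, mul_comm 2 i, mul_comm 2 (k - i), pow_mul, pow_mul]
      nlinarith [sq_nonneg (s ^ i - s ^ (k - i))]
    rw [Finset.sum_add_distrib, h1] at h2
    simp only [Finset.sum_const, Finset.card_range, nsmul_eq_mul] at h2
    linarith
  rcases n with _ | m
  · simp
  have h1 := key m
  have h2 := key (m + 1)
  have h3 := mul_le_mul h1 h2 (by positivity) ((by positivity : (0 : ℝ) ≤ _).trans h1)
  refine le_trans ?_ h3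
  have h4 : (s ^ 2) ^ (m + 1) ≤ s ^ m * s ^ (m + 1) := by
    rw [← pow_mul, ← pow_add]
    exact pow_le_pow_of_le_one hs0 hs1 (by omega)
  have h5 := mul_le_mul_of_nonneg_left h4 (by positivity : (0 : ℝ) ≤ (m + 1) * (m + 2))
  push_cast
  nlinarith

/-- The weights in the comparison of `L(1, χ)/(1-t)` with a Lambert series decrease. -/
theorem lambert_weight_succ_le {t : ℝ} (ht0 : 0 ≤ t) (ht1 : t < 1) {n : ℕ} (hn : 1 ≤ n) :
    1 / ((n + 1 : ℕ) * (1 - t)) - t ^ (n + 1) / (1 - t ^ (n + 1))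
      ≤ 1 / (n * (1 - t)) - t ^ n / (1 - t ^ n) := by
  obtain ⟨s, hs0, rfl⟩ : ∃ s : ℝ, 0 ≤ s ∧ s ^ 2 = t := ⟨√t, Real.sqrt_nonneg t, Real.sq_sqrt ht0⟩
  have hs1 : s ≤ 1 := by nlinarith
  have h := mul_pow_two_mul_le_geom_sum_mul hs0 hs1 n
  set t := s ^ 2
  have hn0 : (0 : ℝ) < n := by exact_mod_cast hn
  have e1 := geom_sum_mul_neg t n
  have e2 := geom_sum_mul_neg t (n + 1)
  have hA : 0 < ∑ i ∈ Finset.range n, t ^ i := by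
    refine lt_of_lt_of_le zero_lt_one ?_
    have := Finset.single_le_sum (f := fun i => t ^ i) (fun i _ => by positivity)
      (Finset.mem_range.2 hn)
    simpa using this
  have hB : 0 < ∑ i ∈ Finset.range (n + 1), t ^ i := by
    rw [Finset.sum_range_succ]
    positivity
  set A := ∑ i ∈ Finset.range n, t ^ i
  set B := ∑ i ∈ Finset.range (n + 1), t ^ i
  have h1t : 0 < 1 - t := by linarith
  have hBA : B = 1 + t * A := by
    have : B * (1 - t) = (1 + t * A) * (1 - t) := by
      rw [e2, add_mul, mul_assoc, e1]
      ring
    exact mul_right_cancel₀ h1t.ne' this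
  have hBA' : B = A + t ^ n := Finset.sum_range_succ _ _
  rw [← e1, ← e2, ← sub_nonneg]
  -- Since `B = 1 + t A`, monotonicity reduces to `n (n + 1) t^n ≤ A B`.
  have e : 1 / (n * (1 - t)) - t ^ n / (A * (1 - t))
      - (1 / ((n + 1 : ℕ) * (1 - t)) - t ^ (n + 1) / (B * (1 - t)))
      = (A * B - n * (n + 1) * t ^ n) / (n * (n + 1) * (A * B) * (1 - t)) := by
    have h6 : A * t ^ (n + 1) - t ^ n * B = - t ^ n := by
      rw [hBA, pow_succ]; ring
    have h7 : t ^ n / (A * (1 - t)) - t ^ (n + 1) / (B * (1 - t)) = t ^ n / (A * B * (1 - t)) := by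
      field_simp
      rw [hBA]; ring
    have h8 : 1 / (n * (1 - t)) - 1 / ((n + 1 : ℕ) * (1 - t)) = 1 / (n * (n + 1) * (1 - t)) := by
      push_cast
      field_simp
      ring
    calc _ = (1 / (n * (1 - t)) - 1 / ((n + 1 : ℕ) * (1 - t)))
        - (t ^ n / (A * (1 - t)) - t ^ (n + 1) / (B * (1 - t))) := by ring
      _ = _ := by
        rw [h7, h8]
        field_simp
  rw [e]
  exact div_nonneg (by linarith) (by positivity)

theorem lambert_weight_nonneg {t : ℝ} (ht0 : 0 ≤ t) (ht1 : t < 1) {n : ℕ} (hn : 1 ≤ n) :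
    0 ≤ 1 / (n * (1 - t)) - t ^ n / (1 - t ^ n) := by
  have hn0 : (0 : ℝ) < n := by exact_mod_cast hn
  have h1t : 0 < 1 - t := by linarith
  rw [← geom_sum_mul_neg t n]
  have hA : (n : ℝ) * t ^ n ≤ ∑ i ∈ Finset.range n, t ^ i := by
    have := Finset.card_nsmul_le_sum (Finset.range n) (fun i => t ^ i) (t ^ n) (fun i hi =>
      pow_le_pow_of_le_one ht0 ht1.le (Finset.mem_range.1 hi).le)
    simpa using this
  have hA0 : 0 < ∑ i ∈ Finset.range n, t ^ i := by
    refine lt_of_lt_of_le zero_lt_one ?_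
    have := Finset.single_le_sum (f := fun i => t ^ i) (fun i _ => by positivity)
      (Finset.mem_range.2 hn)
    simpa using this
  rw [sub_nonneg, div_le_div_iff₀ (by positivity) (by positivity)]
  nlinarith

namespace DirichletCharacter

section zetaMul

variable {q : ℕ} (χ : DirichletCharacter ℂ q)

theorem zetaMul_apply (n : ℕ) : zetaMul χ n = ∑ d ∈ n.divisors, χ (d : ZMod q) := by
  rw [zetaMul, ArithmeticFunction.coe_zeta_mul_apply]
  refine Finset.sum_congr rfl fun d hd => ?_
  have := (Nat.pos_of_mem_divisors hd).ne'
  simp [toArithmeticFunction, this]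

theorem summable_prod_mul_pow_mul {t : ℝ} (ht0 : 0 ≤ t) (ht1 : t < 1) :
    Summable fun c : ℕ+ × ℕ+ => χ ((c.1 : ℕ) : ZMod q) * (t : ℂ) ^ (c.1 * c.2 : ℕ) := by
  have h := summable_prod_mul_pow (𝕜 := ℝ) 0 (r := t) (by rwa [Real.norm_of_nonneg ht0])
  refine Summable.of_norm_bounded h fun c => ?_
  rw [norm_mul, norm_pow, Complex.norm_of_nonneg ht0]
  simpa using mul_le_of_le_one_left (by positivity : 0 ≤ t ^ (c.1 * c.2 : ℕ)) (χ.norm_le_one _)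

/-- Expand `t^n / (1 - t^n)` as `∑ t^(n c)` and regroup the absolutely convergent double series by
the product `n c`. -/
theorem hasSum_lambert {t : ℝ} (ht0 : 0 ≤ t) (ht1 : t < 1) :
    HasSum (fun n : ℕ+ => zetaMul χ n * (t : ℂ) ^ (n : ℕ))
      (∑' n : ℕ+, χ ((n : ℕ) : ZMod q) * ((t : ℂ) ^ (n : ℕ) / (1 - (t : ℂ) ^ (n : ℕ)))) := by
  have hs := summable_prod_mul_pow_mul χ ht0 ht1
  have h1 : ∑' c : ℕ+ × ℕ+, χ ((c.1 : ℕ) : ZMod q) * (t : ℂ) ^ (c.1 * c.2 : ℕ)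
      = ∑' n : ℕ+, χ ((n : ℕ) : ZMod q) * ((t : ℂ) ^ (n : ℕ) / (1 - (t : ℂ) ^ (n : ℕ))) := by
    rw [hs.tsum_prod]
    refine tsum_congr fun n => ?_
    have hmul : ∑' c : ℕ+, χ ((n : ℕ) : ZMod q) * (t : ℂ) ^ (n * c : ℕ)
        = χ ((n : ℕ) : ZMod q) * ∑' c : ℕ+, (t : ℂ) ^ (n * c : ℕ) := tsum_mul_left
    refine hmul.trans ?_
    congr 1
    have hlt : ‖(t : ℂ) ^ (n : ℕ)‖ < 1 := by
      rw [norm_pow, Complex.norm_of_nonneg ht0]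
      exact pow_lt_one₀ ht0 ht1 n.ne_zero
    have := tsum_geometric_of_norm_lt_one hlt
    rw [tsum_pnat_eq_tsum_succ (f := fun m => (t : ℂ) ^ (n * m : ℕ))]
    simp_rw [mul_add, mul_one, pow_add, pow_mul]
    rw [tsum_mul_right, this]
    ring
  rw [← h1]
  have h2 := (sigmaAntidiagonalEquivProd.hasSum_iff.2 hs.hasSum).sigma
    (g := fun n : ℕ+ => zetaMul χ n * (t : ℂ) ^ (n : ℕ)) (fun n => ?_)
  · exact h2
  · have h3 := hasSum_fintype (fun x : (n : ℕ).divisorsAntidiagonal =>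
      ((fun c : ℕ+ × ℕ+ => χ ((c.1 : ℕ) : ZMod q) * (t : ℂ) ^ (c.1 * c.2 : ℕ)) ∘
        sigmaAntidiagonalEquivProd) ⟨n, x⟩)
    convert! h3 using 1
    have e : ∀ x : (n : ℕ).divisorsAntidiagonal,
        ((fun c : ℕ+ × ℕ+ => χ ((c.1 : ℕ) : ZMod q) * (t : ℂ) ^ (c.1 * c.2 : ℕ)) ∘
        sigmaAntidiagonalEquivProd) ⟨n, x⟩ = χ ((x.1.1 : ℕ) : ZMod q) * (t : ℂ) ^ (n : ℕ) := by
      intro x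
      have h4 : x.1.1 * x.1.2 = n := (Nat.mem_divisorsAntidiagonal.mp x.2).1
      simp [sigmaAntidiagonalEquivProd, divisorsAntidiagonalFactors, h4]
    simp_rw [e]
    rw [← Finset.sum_mul, Finset.sum_coe_sort (n : ℕ).divisorsAntidiagonal
      (fun x => χ ((x.1 : ℕ) : ZMod q)),
      Nat.sum_divisorsAntidiagonal (fun d _ => χ ((d : ℕ) : ZMod q))]
    rw [zetaMul_apply]

theorem tendsto_sum_lambert {t : ℝ} (ht0 : 0 ≤ t) (ht1 : t < 1) :
    Tendsto (fun N : ℕ => ∑ n ∈ Finset.Ico 1 N, χ (n : ZMod q) * ((t ^ n / (1 - t ^ n) : ℝ) : ℂ))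
      atTop (𝓝 (∑' n : ℕ+, zetaMul χ n * (t : ℂ) ^ (n : ℕ))) := by
  rw [(hasSum_lambert χ ht0 ht1).tsum_eq, tsum_pnat_eq_tsum_of_eq_zero
    (f := fun n : ℕ => χ (n : ZMod q) * ((t : ℂ) ^ n / (1 - (t : ℂ) ^ n))) (by simp)]
  have hs : Summable (fun n : ℕ => χ (n : ZMod q) * ((t : ℂ) ^ n / (1 - (t : ℂ) ^ n))) := by
    have h := summable_norm_pow_mul_geometric_div_one_sub (𝕜 := ℝ) 0 (r := t)
      (by rwa [Real.norm_of_nonneg ht0])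
    refine Summable.of_norm_bounded h.norm fun n => ?_
    have e : (t : ℂ) ^ n / (1 - (t : ℂ) ^ n) = ((t ^ n / (1 - t ^ n) : ℝ) : ℂ) := by push_cast; rfl
    rw [norm_mul, e, Complex.norm_real]
    simpa using mul_le_of_le_one_left (norm_nonneg (t ^ n / (1 - t ^ n))) (χ.norm_le_one _)
  refine hs.hasSum.tendsto_sum_nat.congr' ?_
  filter_upwards [eventually_ge_atTop 1] with N hN
  rw [Finset.range_eq_Ico, Finset.sum_eq_sum_Ico_succ_bot (by omega)]
  simp

open scoped ComplexOrder

/-- By multiplicativity only prime powers `p^(2k)` matter; there the sum of `χ(p)^i` over `i ≤ 2k`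
is `1`, `2k + 1` or `1` according as `χ(p)` is `0`, `1` or `-1`. -/
theorem one_le_zetaMul_sq {χ : DirichletCharacter ℂ q} (hχ : χ ^ 2 = 1) {m : ℕ} (hm : m ≠ 0) :
    1 ≤ zetaMul χ (m ^ 2) := by
  rw [χ.isMultiplicative_zetaMul.multiplicative_factorization _ (pow_ne_zero 2 hm),
    Nat.factorization_pow, Finsupp.prod]
  refine Finset.prod_induction _ (1 ≤ ·) (fun a b ha hb => one_le_mul_of_one_le_of_one_le ha hb)
    le_rfl fun p hp => ?_
  have hp' : p.Prime := by
    rw [← Nat.factorization_pow] at hp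
    exact Nat.prime_of_mem_primeFactors hp
  rw [Finsupp.smul_apply, smul_eq_mul, zetaMul_apply, Nat.sum_divisors_prime_pow hp']
  simp only [Nat.cast_pow, map_pow]
  rcases MulChar.isQuadratic_iff_sq_eq_one.mpr hχ p with h | h | h
  · rw [Finset.sum_range_succ']
    simp [h]
  · simp only [h, one_pow, Finset.sum_const, Finset.card_range, nsmul_eq_mul, mul_one]
    exact_mod_cast (by omega : 1 ≤ 2 * m.factorization p + 1)
  · rw [h, neg_one_geom_sum, if_neg (by rw [Nat.not_even_iff_odd]; exact odd_two_mul_add_one _)]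

/-- The coefficients are nonnegative, and at least `1` at the squares `1^2, ..., M^2`, which alone
are kept. -/
theorem le_re_tsum_zetaMul {χ : DirichletCharacter ℂ q} (hχ : χ ^ 2 = 1) {t : ℝ} (ht0 : 0 ≤ t)
    (ht1 : t < 1) (M : ℕ) :
    M * t ^ (M ^ 2) ≤ (∑' n : ℕ+, zetaMul χ n * (t : ℂ) ^ (n : ℕ)).re := by
  have hs := (hasSum_lambert χ ht0 ht1).summable
  have hre : ∀ n : ℕ+, (zetaMul χ n * (t : ℂ) ^ (n : ℕ)).re = (zetaMul χ n).re * t ^ (n : ℕ) := by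
    intro n
    rw [← Complex.ofReal_pow, Complex.re_mul_ofReal]
  have hs' : Summable fun n : ℕ+ => (zetaMul χ n).re * t ^ (n : ℕ) := by
    simpa only [hre] using (Complex.hasSum_re hs.hasSum).summable
  rw [Complex.re_tsum hs]
  simp_rw [hre]
  let e : ℕ ↪ ℕ+ := ⟨fun m => ⟨(m + 1) ^ 2, by positivity⟩, fun a b h => by
    have h' : (a + 1) ^ 2 = (b + 1) ^ 2 := congrArg PNat.val h
    have := Nat.pow_left_injective (n := 2) (by norm_num) h'
    omega⟩
  have h1 := hs'.sum_le_tsum ((Finset.range M).map e) (fun n _ =>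
    mul_nonneg (Complex.le_def.1 (zetaMul_nonneg hχ n)).1 (by positivity))
  refine le_trans ?_ h1
  rw [Finset.sum_map]
  have h2 := Finset.card_nsmul_le_sum (Finset.range M)
    (fun m => (zetaMul χ (e m)).re * t ^ ((e m : ℕ+) : ℕ)) (t ^ (M ^ 2)) (fun m hm => ?_)
  · simpa using h2
  · have h3 : 1 ≤ (zetaMul χ ((m + 1) ^ 2)).re :=
      (Complex.le_def.1 (one_le_zetaMul_sq hχ (Nat.succ_ne_zero m))).1
    have h4 : t ^ (M ^ 2) ≤ t ^ ((m + 1) ^ 2) :=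
      pow_le_pow_of_le_one ht0 ht1.le (Nat.pow_le_pow_left (Finset.mem_range.1 hm) 2)
    have h5 : 0 ≤ t ^ ((m + 1) ^ 2) := by positivity
    change _ ≤ (zetaMul χ ((m + 1) ^ 2)).re * t ^ ((m + 1) ^ 2)
    nlinarith

end zetaMul

variable {q : ℕ} [NeZero q] {χ : DirichletCharacter ℂ q}

/-- **Effective nonvanishing** of `L(1, χ)` for quadratic characters. -/
theorem le_norm_of_sq_eq_one (hχ : χ ≠ 1) (hχ2 : χ ^ 2 = 1) {l : ℂ}
    (hl : Tendsto (fun N : ℕ => ∑ n ∈ Finset.Ico 1 N, χ (n : ZMod q) / (n : ℂ)) atTop (𝓝 l)) :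
    1 / (32 * q) ≤ ‖l‖ := by
  have hq : (1 : ℝ) ≤ q := by exact_mod_cast NeZero.pos q
  -- With `ε = 1/(2M^2)`, Bernoulli gives `t^(M^2) ≥ 1/2`, so the Lambert series `F` is at least
  -- `M/2 = 2q`. The comparison weights start at `1`, so `|l/ε - F| ≤ q`; hence `|l| ≥ qε =
  -- 1/(32q)`.
  set M : ℕ := 4 * q with hM
  set ε : ℝ := 1 / (2 * (M : ℝ) ^ 2) with hε
  have hM0 : (0 : ℝ) < M := by rw [hM]; push_cast; linarith
  have hM1 : (1 : ℝ) ≤ M := by rw [hM]; push_cast; linarith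
  have hε0 : 0 < ε := by positivity
  have hε1 : ε ≤ 1 := by
    rw [hε, div_le_one (by positivity)]
    nlinarith
  have hεM : (M : ℝ) ^ 2 * ε = 1 / 2 := by
    rw [hε]; field_simp
  set t : ℝ := 1 - ε with ht
  have ht0 : 0 ≤ t := by linarith
  have ht1 : t < 1 := by linarith
  have hpow : 1 / 2 ≤ t ^ (M ^ 2) := by
    have := one_add_mul_le_pow (a := -ε) (by linarith) (M ^ 2)
    push_cast at this
    rw [ht, sub_eq_add_neg]
    linarith
  have hlow := le_re_tsum_zetaMul hχ2 ht0 ht1 M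
  set F := ∑' n : ℕ+, zetaMul χ n * (t : ℂ) ^ (n : ℕ)
  have hF : 2 * q ≤ ‖F‖ := by
    refine le_trans ?_ (hlow.trans (Complex.re_le_norm F))
    have := mul_le_mul_of_nonneg_left hpow hM0.le
    rw [hM] at this ⊢
    push_cast at this ⊢
    linarith
  have hlim := (hl.mul_const (1 / ε : ℂ)).sub (tendsto_sum_lambert χ ht0 ht1)
  have hbd : ‖l * (1 / ε : ℂ) - F‖ ≤ q := by
    refine le_of_tendsto hlim.norm (Eventually.of_forall fun N => ?_)
    have h := norm_sum_Ico_mul_le (c := fun n => χ (n : ZMod q)) (norm_sum_Ico_le hχ)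
      (f := fun n => 1 / (n * (1 - t)) - t ^ n / (1 - t ^ n)) (m := 1)
      (fun i hi => lambert_weight_succ_le ht0 ht1 hi)
      (fun i hi => lambert_weight_nonneg ht0 ht1 hi) N
    have e1 : 1 / (((1 : ℕ) : ℝ) * (1 - t)) - t ^ 1 / (1 - t ^ 1) = 1 := by
      have : 1 - t ≠ 0 := by linarith
      push_cast
      field_simp
    rw [e1, one_mul] at h
    refine le_of_eq_of_le ?_ h
    rw [Finset.sum_mul, ← Finset.sum_sub_distrib]
    congr 1
    refine Finset.sum_congr rfl fun n _ => ?_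
    have e2 : 1 - t = ε := by rw [ht]; ring
    rw [e2]
    push_cast
    ring
  have h1 : (q : ℝ) ≤ ‖l‖ * (1 / ε) := by
    have h2 := norm_sub_norm_le F (l * (1 / ε : ℂ))
    rw [norm_sub_rev] at h2
    have h3 : ‖l * (1 / ε : ℂ)‖ = ‖l‖ * (1 / ε) := by
      rw [norm_mul, ← Complex.ofReal_one, ← Complex.ofReal_div, Complex.norm_of_nonneg (by positivity)]
    linarith
  have h2 : 1 / ε = 32 * (q : ℝ) ^ 2 := by
    rw [hε, hM]; push_cast; field_simp; norm_num
  rw [h2] at h1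
  rw [div_le_iff₀ (by positivity)]
  nlinarith

-- Termwise comparison with `ζ(1 + δ) ≤ 1 + 1/δ`.
omit [NeZero q] in
theorem norm_LSeries_one_le {δ : ℝ} (hδ : 0 < δ) (hδ1 : δ ≤ 1) :
    ‖LSeries (fun n => (1 : DirichletCharacter ℂ q) (n : ZMod q)) (1 + δ)‖ ≤ 2 / δ := by
  have hs : Summable fun n : ℕ => 1 / (n : ℝ) ^ (1 + δ) :=
    Real.summable_one_div_nat_rpow.2 (by linarith)
  have h1 : ‖LSeries (fun n => (1 : DirichletCharacter ℂ q) (n : ZMod q)) (1 + δ)‖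
      ≤ ∑' n : ℕ, 1 / (n : ℝ) ^ (1 + δ) := by
    refine tsum_of_norm_bounded hs.hasSum fun n => ?_
    rcases eq_or_ne n 0 with rfl | hn
    · simp only [LSeries.term_zero, norm_zero]
      positivity
    · rw [LSeries.term_of_ne_zero hn, norm_div, Complex.norm_natCast_cpow_of_pos (by omega)]
      simp only [Complex.add_re, Complex.one_re, Complex.ofReal_re]
      gcongr
      exact norm_le_one _ _
  have h2 := ZetaAsymptotics.zeta_limit_aux1 (s := 1 + δ) (by linarith)
  have h3 : 0 ≤ ZetaAsymptotics.termTSum (1 + δ) :=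
    tsum_nonneg fun n => ZetaAsymptotics.term_nonneg _ _
  rw [hs.tsum_eq_zero_add] at h1
  simp only [Nat.cast_zero, Nat.cast_add, Nat.cast_one] at h1
  rw [Real.zero_rpow (by linarith)] at h1
  have h4 : 1 ≤ 1 / δ := by rw [le_div_iff₀ hδ]; linarith
  have h5 : 2 / δ = 1 / δ + 1 / δ := by ring
  have h6 : 0 ≤ (1 + δ) * ZetaAsymptotics.termTSum (1 + δ) := by positivity
  rw [add_sub_cancel_left] at h2
  simp only [div_zero, zero_add] at h1
  linarith

/-- The 3-4-1 inequality at `1 + δ` says `a^3 b^4 c ≥ 1`, with `a ≤ 2/δ`, and `c ≤ q` because `χ^2`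
is nontrivial. If `|l| < 2qδ` then `b ≤ 4qδ`, and the product is at most `2048 q^5 δ`, which the
choice of `δ` makes `1/2`. -/
theorem le_norm_of_sq_ne_one (hχ : χ ≠ 1) (hχ2 : χ ^ 2 ≠ 1) {l : ℂ}
    (hl : Tendsto (fun N : ℕ => ∑ n ∈ Finset.Ico 1 N, χ (n : ZMod q) / (n : ℂ)) atTop (𝓝 l)) :
    1 / (2048 * (q : ℝ) ^ 4) ≤ ‖l‖ := by
  have hq : (1 : ℝ) ≤ q := by exact_mod_cast NeZero.pos q
  set δ : ℝ := 1 / (4096 * (q : ℝ) ^ 5) with hδ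
  have hδ0 : 0 < δ := by positivity
  have hq5 : (1 : ℝ) ≤ (q : ℝ) ^ 5 := one_le_pow₀ hq
  have hδ1 : δ ≤ 1 := by
    rw [hδ, div_le_one (by positivity)]
    linarith
  have hprod := norm_LSeries_product_ge_one χ hδ0 0
  simp only [Complex.ofReal_zero, mul_zero, add_zero] at hprod
  have hA := norm_LSeries_one_le (q := q) hδ0 hδ1
  have hB := norm_sub_LSeries_le hχ hl hδ0
  have hC := norm_LSeries_le hχ2 (σ := 1 + δ) (by linarith)
  push_cast at hB hC
  rw [norm_mul, norm_mul, norm_pow, norm_pow] at hprod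
  set a := ‖LSeries (fun n => (1 : DirichletCharacter ℂ q) (n : ZMod q)) (1 + δ)‖
  set b := ‖LSeries (fun n => χ (n : ZMod q)) (1 + δ)‖
  set c := ‖LSeries (fun n => (χ ^ 2) (n : ZMod q)) (1 + δ)‖
  by_contra hlt
  push Not at hlt
  have h2 : 2 * q * δ = 1 / (2048 * (q : ℝ) ^ 4) := by
    rw [hδ]; field_simp; norm_num
  have hb : b ≤ 4 * q * δ := by
    have := norm_sub_norm_le (LSeries (fun n => χ (n : ZMod q)) (1 + δ)) l
    rw [norm_sub_rev] at this
    linarith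
  have ha0 : 0 ≤ a := norm_nonneg _
  have hb0 : 0 ≤ b := norm_nonneg _
  have h3 : a ^ 3 * b ^ 4 * c ≤ (2 / δ) ^ 3 * (4 * q * δ) ^ 4 * q := by gcongr
  have h4 : (2 / δ) ^ 3 * (4 * q * δ) ^ 4 * q = 1 / 2 := by
    have : (2 / δ) ^ 3 * (4 * q * δ) ^ 4 * q = 2048 * (q : ℝ) ^ 5 * δ := by
      field_simp
      norm_num
    rw [this, hδ]
    field_simp
    norm_num
  linarith

/-- **Effective nonvanishing** of `L(1, χ)`, with a polynomial lower bound. -/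
theorem le_norm_of_ne_one (hχ : χ ≠ 1) {l : ℂ}
    (hl : Tendsto (fun N : ℕ => ∑ n ∈ Finset.Ico 1 N, χ (n : ZMod q) / (n : ℂ)) atTop (𝓝 l)) :
    1 / (2048 * (q : ℝ) ^ 4) ≤ ‖l‖ := by
  by_cases h2 : χ ^ 2 = 1
  · refine le_trans ?_ (le_norm_of_sq_eq_one hχ h2 hl)
    have hq : (1 : ℝ) ≤ q := by exact_mod_cast NeZero.pos q
    have : (q : ℝ) ≤ (q : ℝ) ^ 4 := le_self_pow₀ hq (by norm_num)
    gcongr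
    linarith
  · exact le_norm_of_sq_ne_one hχ h2 hl

end DirichletCharacter

/-! ### Mertens' estimate and tails over primes. -/

/-- Proper prime powers are negligible; modulus `1` in the residue-class summability covers every
`n`. -/
theorem exists_nonprime_vonMangoldt_bound : ∃ K : ℝ, 0 ≤ K ∧ ∀ s : Finset ℕ,
    ∑ n ∈ s, (if n.Prime then 0 else ArithmeticFunction.vonMangoldt n / n) ≤ K := by
  have h := ArithmeticFunction.vonMangoldt.summable_residueClass_non_primes_div (q := 1) 0
  have e : ∀ n : ℕ, ((if n.Prime then 0 else
      ArithmeticFunction.vonMangoldt.residueClass (0 : ZMod 1) n) / n : ℝ)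
      = if n.Prime then 0 else ArithmeticFunction.vonMangoldt n / n := by
    intro n
    rw [ite_div, zero_div, ArithmeticFunction.vonMangoldt.residueClass, Set.indicator_of_mem]
    exact Subsingleton.elim _ _
  simp_rw [e] at h
  have h0 : ∀ n : ℕ, 0 ≤ (if n.Prime then 0 else ArithmeticFunction.vonMangoldt n / n : ℝ) := by
    intro n
    have := ArithmeticFunction.vonMangoldt_nonneg (n := n)
    split_ifs <;> positivity
  exact ⟨_, tsum_nonneg h0, fun s => h.sum_le_tsum s fun n _ => h0 n⟩

namespace DirichletCharacter

section

variable {q : ℕ} (χ : DirichletCharacter ℂ q)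

/-- The identity `Λ * 1 = log`, twisted by the completely multiplicative `χ(n)/n` and summed over `n
≤ N`. -/
theorem sum_vonMangoldt_div_mul_sum_div (N : ℕ) :
    ∑ d ∈ Finset.Ioc 0 N, χ (d : ZMod q) * (ArithmeticFunction.vonMangoldt d / d : ℝ) *
      ∑ m ∈ Finset.Ioc 0 (N / d), χ (m : ZMod q) / (m : ℂ)
      = ∑ n ∈ Finset.Ioc 0 N, χ (n : ZMod q) * (Real.log n / n : ℝ) := by
  let F : ArithmeticFunction ℂ :=
    ⟨fun d => χ (d : ZMod q) * (ArithmeticFunction.vonMangoldt d / d : ℝ), by simp⟩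
  let G : ArithmeticFunction ℂ := ⟨fun m => χ (m : ZMod q) / (m : ℂ), by simp⟩
  rw [show ∑ d ∈ Finset.Ioc 0 N, χ (d : ZMod q) * (ArithmeticFunction.vonMangoldt d / d : ℝ) *
      ∑ m ∈ Finset.Ioc 0 (N / d), χ (m : ZMod q) / (m : ℂ)
      = ∑ d ∈ Finset.Ioc 0 N, F d * ∑ m ∈ Finset.Ioc 0 (N / d), G m from rfl,
    ← ArithmeticFunction.sum_Ioc_mul_eq_sum_sum]
  refine Finset.sum_congr rfl fun n hn => ?_
  have hn0 : n ≠ 0 := (Finset.mem_Ioc.1 hn).1.ne'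
  rw [ArithmeticFunction.mul_apply, ← ArithmeticFunction.vonMangoldt_sum,
    ← Nat.sum_divisorsAntidiagonal (fun d _ => ArithmeticFunction.vonMangoldt d)]
  rw [Finset.sum_div, Complex.ofReal_sum, Finset.mul_sum]
  refine Finset.sum_congr rfl fun x hx => ?_
  obtain ⟨h1, -⟩ := Nat.mem_divisorsAntidiagonal.1 hx
  change χ (x.1 : ZMod q) * (ArithmeticFunction.vonMangoldt x.1 / x.1 : ℝ) *
    (χ (x.2 : ZMod q) / (x.2 : ℂ)) = _
  rw [← h1]
  push_cast
  rw [map_mul]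
  have h2 : x.1 ≠ 0 := by rintro h; simp [h] at h1; exact hn0 h1.symm
  have h3 : x.2 ≠ 0 := by rintro h; simp [h] at h1; exact hn0 h1.symm
  have h2' : (x.1 : ℂ) ≠ 0 := by exact_mod_cast h2
  have h3' : (x.2 : ℂ) ≠ 0 := by exact_mod_cast h3
  field_simp

end

variable {q : ℕ} [NeZero q] {χ : DirichletCharacter ℂ q}

/-- **Mertens' estimate** for a nontrivial character. -/
theorem norm_mul_sum_vonMangoldt_div_le (hχ : χ ≠ 1) {l : ℂ}
    (hl : Tendsto (fun N : ℕ => ∑ n ∈ Finset.Ico 1 N, χ (n : ZMod q) / (n : ℂ)) atTop (𝓝 l))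
    (N : ℕ) :
    ‖l‖ * ‖∑ d ∈ Finset.Ioc 0 N, χ (d : ZMod q) * (ArithmeticFunction.vonMangoldt d / d : ℝ)‖
      ≤ 8 * q := by
  rcases Nat.eq_zero_or_pos N with rfl | hN
  · simp
  have hN0 : (0 : ℝ) < N := by exact_mod_cast hN
  have hIoc : ∀ N : ℕ, Finset.Ioc 0 N = Finset.Ico 1 (N + 1) := fun N => by ext; simp; omega
  have hT := norm_sum_Ico_log_le hχ 1 (N + 1)
  rw [← hIoc, ← sum_vonMangoldt_div_mul_sum_div] at hT
  set S := ∑ d ∈ Finset.Ioc 0 N, χ (d : ZMod q) * (ArithmeticFunction.vonMangoldt d / d : ℝ)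
  set T := ∑ d ∈ Finset.Ioc 0 N, χ (d : ZMod q) * (ArithmeticFunction.vonMangoldt d / d : ℝ) *
      ∑ m ∈ Finset.Ioc 0 (N / d), χ (m : ZMod q) / (m : ℂ)
  -- Replacing the inner sum by `l` costs at most `q d / N`; the `d` cancels the one in `Λ(d)/d`,
  -- leaving `(q/N) ψ(N)`, and Chebyshev gives `ψ(N) ≤ 6N`.
  have hdiff : ‖S * l - T‖ ≤ 6 * q := by
    rw [Finset.sum_mul, ← Finset.sum_sub_distrib]
    have hb : ∀ d ∈ Finset.Ioc 0 N,
        ‖χ (d : ZMod q) * (ArithmeticFunction.vonMangoldt d / d : ℝ) * l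
          - χ (d : ZMod q) * (ArithmeticFunction.vonMangoldt d / d : ℝ) *
          ∑ m ∈ Finset.Ioc 0 (N / d), χ (m : ZMod q) / (m : ℂ)‖
        ≤ ArithmeticFunction.vonMangoldt d * (q / N) := by
      intro d hd
      have hd0 : 0 < d := (Finset.mem_Ioc.1 hd).1
      have hd0' : (0 : ℝ) < d := by exact_mod_cast hd0
      have hΛ := ArithmeticFunction.vonMangoldt_nonneg (n := d)
      rw [← mul_sub, norm_mul, norm_mul, hIoc, Complex.norm_of_nonneg (by positivity)]
      have h1 := norm_sub_sum_div_le hχ hl (a := N / d + 1) (Nat.le_add_left 1 _)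
      have h2 : (q : ℝ) / ((N / d + 1 : ℕ) : ℝ) ≤ q * d / N := by
        have h3 : (N : ℝ) ≤ d * ((N / d + 1 : ℕ) : ℝ) := by
          exact_mod_cast (Nat.lt_mul_div_succ N hd0).le
        rw [div_le_div_iff₀ (by positivity) hN0, mul_assoc]
        exact mul_le_mul_of_nonneg_left h3 (Nat.cast_nonneg q)
      calc _ ≤ 1 * (ArithmeticFunction.vonMangoldt d / d) * (q * d / N) := by
            gcongr
            · exact χ.norm_le_one _
            · exact h1.trans h2
        _ = _ := by field_simp
    refine (norm_sum_le_of_le _ hb).trans ?_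
    rw [← Finset.sum_mul]
    have hψ := Chebyshev.psi_le_const_mul_self (x := N) hN0.le
    rw [Chebyshev.psi, Nat.floor_natCast] at hψ
    have h4 : Real.log 4 ≤ 2 := by
      rw [show (4 : ℝ) = 2 ^ 2 by norm_num, Real.log_pow]
      have := Real.log_two_lt_d9
      push_cast
      linarith
    have h5 : ∑ d ∈ Finset.Ioc 0 N, ArithmeticFunction.vonMangoldt d ≤ 6 * N :=
      hψ.trans (mul_le_mul_of_nonneg_right (by linarith) hN0.le)
    calc _ ≤ 6 * (N : ℝ) * (q / N) := by gcongr
      _ = 6 * q := by field_simp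
  rw [mul_comm, ← norm_mul]
  have := norm_sub_norm_le (S * l) T
  linarith

/-- Tails of `∑ χ(p)/p^σ`, uniformly for `σ > 1`. -/
theorem exists_norm_sum_prime_le : ∃ K : ℝ, 0 < K ∧ ∀ (q : ℕ) [NeZero q]
    (χ : DirichletCharacter ℂ q), χ ≠ 1 → ∀ σ : ℝ, 1 < σ → ∀ y : ℕ, 2 ≤ y → ∀ N : ℕ,
    ‖∑ p ∈ Finset.Ico y N with p.Prime, χ (p : ZMod q) * (1 / (p : ℝ) ^ σ : ℝ)‖
      ≤ K * (q : ℝ) ^ 5 / Real.log y := by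
  obtain ⟨K, hK0, hK⟩ := exists_nonprime_vonMangoldt_bound
  refine ⟨2 * (8 * 2048) + K, by positivity, fun q _ χ hχ σ hσ y hy N => ?_⟩
  have hq : (1 : ℝ) ≤ q := by exact_mod_cast NeZero.pos q
  obtain ⟨l, hl⟩ := exists_tendsto_sum_div hχ
  have hlow := le_norm_of_ne_one hχ hl
  set B : ℝ := 8 * 2048 * (q : ℝ) ^ 5 with hB
  have hpart : ∀ N : ℕ, ‖∑ d ∈ Finset.Ioc 0 N,
      χ (d : ZMod q) * (ArithmeticFunction.vonMangoldt d / d : ℝ)‖ ≤ B := by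
    intro N
    have h := (mul_le_mul_of_nonneg_right hlow (norm_nonneg _)).trans
      (norm_mul_sum_vonMangoldt_div_le hχ hl N)
    rw [div_mul_eq_mul_div, one_mul, div_le_iff₀ (by positivity)] at h
    rw [hB]
    linarith
  have hIco : ∀ m n : ℕ, ‖∑ d ∈ Finset.Ico m n,
      χ (d : ZMod q) * (ArithmeticFunction.vonMangoldt d / d : ℝ)‖ ≤ 2 * B := by
    have h0 : ∀ n : ℕ, ‖∑ d ∈ Finset.range n,
        χ (d : ZMod q) * (ArithmeticFunction.vonMangoldt d / d : ℝ)‖ ≤ B := by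
      intro n
      rcases n with _ | n
      · simpa using (by positivity : 0 ≤ B)
      · have h := hpart n
        have e : Finset.range (n + 1) = insert 0 (Finset.Ioc 0 n) := by ext; simp
        rw [e, Finset.sum_insert (by simp)]
        simpa using h
    intro m n
    rcases le_total m n with hmn | hmn
    · rw [Finset.sum_Ico_eq_sub _ hmn]
      refine (norm_sub_le _ _).trans ?_
      linarith [h0 m, h0 n]
    · rw [Finset.Ico_eq_empty_of_le hmn]
      simpa using (by positivity : 0 ≤ B)
  -- At a prime, `f p * (log p / p) = p^(-σ)`, so Abel summation with these weights passes from
  -- `Λ(n)/n` to `p^(-σ)`. The bound `f ≤ 1 / log y` does not depend on `σ`.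
  set f : ℕ → ℝ := fun n => 1 / (Real.log n * (n : ℝ) ^ (σ - 1)) with hf
  have hlog : ∀ i : ℕ, y ≤ i → 0 < Real.log i := fun i hi =>
    Real.log_pos (by exact_mod_cast (by omega : 1 < i))
  have hpos : ∀ i : ℕ, y ≤ i → (0 : ℝ) < i := fun i hi => by exact_mod_cast (by omega : 0 < i)
  have hfle : ∀ i, y ≤ i → f i ≤ 1 / Real.log y := by
    intro i hi
    have h1 := hlog y le_rfl
    have h2 : Real.log y ≤ Real.log i := Real.log_le_log (hpos y le_rfl) (by exact_mod_cast hi)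
    have h3 : (1 : ℝ) ≤ (i : ℝ) ^ (σ - 1) :=
      Real.one_le_rpow (by exact_mod_cast (by omega : 1 ≤ i)) (by linarith)
    refine one_div_le_one_div_of_le h1 ?_
    nlinarith
  have hf0 : ∀ i, y ≤ i → 0 ≤ f i := fun i hi => by
    have := hlog i hi
    positivity
  have hall := norm_sum_Ico_mul_le hIco (f := f) (m := y)
    (fun i hi => by
      have h1 := hlog i hi
      have h2 := hpos i hi
      have h3 := hlog (i + 1) (by omega)
      simp only [hf]
      push_cast at h3 ⊢
      gcongr <;> linarith) hf0 N
  have hsplit : ∑ i ∈ Finset.Ico y N, (f i : ℂ) *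
      (χ (i : ZMod q) * (ArithmeticFunction.vonMangoldt i / i : ℝ))
      = ∑ p ∈ Finset.Ico y N with p.Prime, χ (p : ZMod q) * (1 / (p : ℝ) ^ σ : ℝ)
      + ∑ i ∈ Finset.Ico y N with ¬ i.Prime, (f i : ℂ) *
      (χ (i : ZMod q) * (ArithmeticFunction.vonMangoldt i / i : ℝ)) := by
    rw [← Finset.sum_filter_add_sum_filter_not (Finset.Ico y N) Nat.Prime]
    congr 1
    refine Finset.sum_congr rfl fun p hp => ?_
    simp only [Finset.mem_filter, Finset.mem_Ico] at hp
    rw [ArithmeticFunction.vonMangoldt_apply_prime hp.2]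
    have h1 := hlog p hp.1.1
    have h2 := hpos p hp.1.1
    have e : f p * (Real.log p / p) = 1 / (p : ℝ) ^ σ := by
      simp only [hf]
      rw [Real.rpow_sub h2, Real.rpow_one]
      have : 0 < (p : ℝ) ^ σ := by positivity
      field_simp
    rw [← e]
    push_cast
    ring
  have hnon : ‖∑ i ∈ Finset.Ico y N with ¬ i.Prime, (f i : ℂ) *
      (χ (i : ZMod q) * (ArithmeticFunction.vonMangoldt i / i : ℝ))‖ ≤ K / Real.log y := by
    have hb : ∀ i ∈ (Finset.Ico y N).filter (fun i => ¬ i.Prime), ‖(f i : ℂ) *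
        (χ (i : ZMod q) * (ArithmeticFunction.vonMangoldt i / i : ℝ))‖
        ≤ 1 / Real.log y * (if i.Prime then 0 else ArithmeticFunction.vonMangoldt i / i) := by
      intro i hi
      simp only [Finset.mem_filter, Finset.mem_Ico] at hi
      have hΛ := ArithmeticFunction.vonMangoldt_nonneg (n := i)
      have h1 := hlog y le_rfl
      rw [if_neg hi.2, norm_mul, norm_mul, Complex.norm_of_nonneg (hf0 i hi.1.1),
        Complex.norm_of_nonneg (by positivity)]
      refine mul_le_mul (hfle i hi.1.1) ?_ (by positivity) (by positivity)
      exact mul_le_of_le_one_left (by positivity) (χ.norm_le_one _)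
    refine (norm_sum_le_of_le _ hb).trans ?_
    rw [← Finset.mul_sum, one_div_mul_eq_div]
    have h1 := hlog y le_rfl
    gcongr
    exact hK _
  have hly := hlog y le_rfl
  have h1 : ‖∑ p ∈ Finset.Ico y N with p.Prime, χ (p : ZMod q) * (1 / (p : ℝ) ^ σ : ℝ)‖
      ≤ 1 / Real.log y * (2 * B) + K / Real.log y := by
    rw [eq_sub_of_add_eq hsplit.symm]
    refine (norm_sub_le _ _).trans (add_le_add (hall.trans ?_) hnon)
    exact mul_le_mul_of_nonneg_right (hfle y le_rfl) (by positivity)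
  refine h1.trans ?_
  rw [one_div_mul_eq_div, ← add_div]
  gcongr
  have : K ≤ K * (q : ℝ) ^ 5 := le_mul_of_one_le_right hK0 (one_le_pow₀ hq)
  rw [hB]
  linarith

end DirichletCharacter

/-! ### Selberg's sieve and Brun–Titchmarsh. -/

section Orthogonality

open ArithmeticFunction

/-- For `r = k m`, write `d = k c`: then `μ(d) = μ(k) μ(c)`, and the sum of `μ(c)` over `c ∣ m`
vanishes unless `m = 1`. -/
theorem sum_moebius_multiples {r : ℕ} (hr : Squarefree r) (k : ℕ) :
    ∑ d ∈ r.divisors with k ∣ d, (moebius d : ℝ) = if k = r then (moebius r : ℝ) else 0 := by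
  have hr0 : r ≠ 0 := hr.ne_zero
  by_cases hk : k ∣ r
  · obtain ⟨m, rfl⟩ := hk
    have hk0 : k ≠ 0 := by rintro rfl; simp at hr0
    have hm0 : m ≠ 0 := by rintro rfl; simp at hr0
    have e : (k * m).divisors.filter (fun d => k ∣ d) = m.divisors.image (fun d => k * d) := by
      ext d
      simp only [Finset.mem_filter, Nat.mem_divisors, Finset.mem_image]
      constructor
      · rintro ⟨⟨h1, -⟩, c, rfl⟩
        exact ⟨c, ⟨Nat.dvd_of_mul_dvd_mul_left (Nat.pos_of_ne_zero hk0) h1, hm0⟩, rfl⟩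
      · rintro ⟨c, ⟨h1, -⟩, rfl⟩
        exact ⟨⟨Nat.mul_dvd_mul_left k h1, hr0⟩, dvd_mul_right _ _⟩
    rw [e, Finset.sum_image (fun a _ b _ h => Nat.eq_of_mul_eq_mul_left (Nat.pos_of_ne_zero hk0) h)]
    have hcop := Nat.coprime_of_squarefree_mul hr
    have h1 : ∀ d ∈ m.divisors, (moebius (k * d) : ℝ) = moebius k * moebius d := by
      intro d hd
      rw [isMultiplicative_moebius.map_mul_of_coprime
        (hcop.coprime_dvd_right (Nat.dvd_of_mem_divisors hd))]
      push_cast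
      rfl
    rw [Finset.sum_congr rfl h1, ← Finset.mul_sum]
    have h2 : ∑ d ∈ m.divisors, (moebius d : ℝ) = if m = 1 then 1 else 0 := by
      have := congrArg (fun f : ArithmeticFunction ℤ => f m) moebius_mul_coe_zeta
      simp only [coe_mul_zeta_apply, one_apply] at this
      exact_mod_cast this
    rw [h2]
    by_cases hm : m = 1
    · subst hm; simp
    · rw [if_neg hm, if_neg (fun h => hm ?_)]
      · simp
      · exact Nat.eq_of_mul_eq_mul_left (Nat.pos_of_ne_zero hk0) (by rw [← h, mul_one])
  · rw [if_neg (by rintro rfl; exact hk dvd_rfl), Finset.filter_false_of_mem]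
    · simp
    · exact fun d hd h => hk (h.trans (Nat.dvd_of_mem_divisors hd))

/-- Writing the gcd as the sum of `φ(k)` over its divisors diagonalises the form: the two inner sums
force `k = r` and `k = s`. This removes the cross terms in the sieve. -/
theorem sum_moebius_mul_gcd {r s : ℕ} (hr : Squarefree r) (hs : Squarefree s) :
    ∑ d ∈ r.divisors, ∑ e ∈ s.divisors, (moebius d : ℝ) * moebius e * (Nat.gcd d e : ℝ)
      = if r = s then (r.totient : ℝ) else 0 := by
  have h1 : ∀ d ∈ r.divisors, ∀ e ∈ s.divisors, (Nat.gcd d e : ℝ)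
      = ∑ k ∈ r.divisors, (k.totient : ℝ) * ((if k ∣ d then 1 else 0) * (if k ∣ e then 1 else 0)) := by
    intro d hd e _
    have hd' := Nat.mem_divisors.1 hd
    have hd0 : d ≠ 0 := (Nat.pos_of_mem_divisors hd).ne'
    rw [← Nat.sum_totient (Nat.gcd d e), Nat.cast_sum]
    have e1 : (Nat.gcd d e).divisors = r.divisors.filter (fun k => k ∣ d ∧ k ∣ e) := by
      ext k
      simp only [Nat.mem_divisors, Finset.mem_filter, Nat.dvd_gcd_iff]
      exact ⟨fun h => ⟨⟨h.1.1.trans hd'.1, hd'.2⟩, h.1⟩,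
        fun h => ⟨h.2, Nat.gcd_ne_zero_left hd0⟩⟩
    rw [e1, Finset.sum_filter]
    refine Finset.sum_congr rfl fun k _ => ?_
    by_cases h2 : k ∣ d <;> by_cases h3 : k ∣ e <;> simp [h2, h3]
  have h2 : ∑ d ∈ r.divisors, ∑ e ∈ s.divisors, (moebius d : ℝ) * moebius e * (Nat.gcd d e : ℝ)
      = ∑ k ∈ r.divisors, (k.totient : ℝ) * ((∑ d ∈ r.divisors with k ∣ d, (moebius d : ℝ)) *
        ∑ e ∈ s.divisors with k ∣ e, (moebius e : ℝ)) := by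
    calc _ = ∑ d ∈ r.divisors, ∑ e ∈ s.divisors, ∑ k ∈ r.divisors, (k.totient : ℝ) *
          ((if k ∣ d then (moebius d : ℝ) else 0) * (if k ∣ e then (moebius e : ℝ) else 0)) := by
          refine Finset.sum_congr rfl fun d hd => Finset.sum_congr rfl fun e he => ?_
          rw [h1 d hd e he, Finset.mul_sum]
          refine Finset.sum_congr rfl fun k _ => ?_
          by_cases h2 : k ∣ d <;> by_cases h3 : k ∣ e <;> simp [h2, h3]
          ring
      _ = _ := by
          simp_rw [Finset.sum_filter, Finset.sum_mul_sum, Finset.mul_sum]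
          exact (Finset.sum_congr rfl fun d _ => Finset.sum_comm).trans Finset.sum_comm
  rw [h2]
  simp_rw [sum_moebius_multiples hr, sum_moebius_multiples hs]
  by_cases h : r = s
  · subst h
    rw [if_pos rfl, Finset.sum_eq_single_of_mem r (Nat.mem_divisors_self r hr.ne_zero)]
    · have : (moebius r : ℝ) * moebius r = 1 := by
        have := moebius_sq_eq_one_of_squarefree hr
        rw [← sq]
        exact_mod_cast this
      simp [this]
    · intro k _ hk
      simp [hk]
  · rw [if_neg h]
    refine Finset.sum_eq_zero fun k _ => ?_
    by_cases hk : k = r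
    · have : k ≠ s := fun h' => h (hk.symm.trans h')
      simp [this]
    · simp [hk]

end Orthogonality

/-- **Selberg's sieve** in dual form. -/
theorem selberg_sieve_bound (A 𝓡 : Finset ℕ) {X : ℝ} (R : ℕ)
    (h𝓡 : ∀ r ∈ 𝓡, Squarefree r ∧ r ≤ R)
    (hA : ∀ r ∈ 𝓡, ∀ s ∈ 𝓡, ∀ d ∈ r.divisors, ∀ e ∈ s.divisors,
      |(((A.filter (fun n => Nat.lcm d e ∣ n)).card : ℝ) - X / Nat.lcm d e)| ≤ 1) :
    (∑ r ∈ 𝓡, 1 / (r.totient : ℝ)) ^ 2 *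
        ((A.filter (fun n => ∀ r ∈ 𝓡, Nat.Coprime n r)).card : ℝ)
      ≤ X * (∑ r ∈ 𝓡, 1 / (r.totient : ℝ)) + ((R : ℝ) ^ 3) ^ 2 := by
  set S := ∑ r ∈ 𝓡, 1 / (r.totient : ℝ) with hS
  -- `f n` sums, over `r`, `1/φ(r)` times the sum of `μ(d) d` over `d ∣ (r, n)`, which up to the
  -- sign `μ(r)` is a Ramanujan sum. It equals `S` at the sifted `n`, while by orthogonality its
  -- square sums over `A` to `X S` plus an error.
  let P : Finset (Σ _ : ℕ, ℕ) := 𝓡.sigma fun r => r.divisors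
  let c : (Σ _ : ℕ, ℕ) → ℝ := fun x => 1 / (x.1.totient : ℝ) * (ArithmeticFunction.moebius x.2 * x.2)
  let f : ℕ → ℝ := fun n => ∑ x ∈ P, if x.2 ∣ n then c x else 0
  have hpos : ∀ r ∈ 𝓡, 0 < r := fun r hr => Nat.pos_of_ne_zero (h𝓡 r hr).1.ne_zero
  have hf : ∀ n, (∀ r ∈ 𝓡, Nat.Coprime n r) → f n = S := by
    intro n hn
    simp only [f, P]
    rw [Finset.sum_sigma, hS]
    refine Finset.sum_congr rfl fun r hr => ?_
    rw [Finset.sum_eq_single_of_mem 1 (Nat.one_mem_divisors.2 (hpos r hr).ne')]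
    · simp [c]
    · intro d hd hd1
      rw [if_neg]
      exact fun h => hd1 (Nat.eq_one_of_dvd_coprimes (hn r hr) h (Nat.dvd_of_mem_divisors hd))
  have hlow : S ^ 2 * ((A.filter (fun n => ∀ r ∈ 𝓡, Nat.Coprime n r)).card : ℝ)
      ≤ ∑ n ∈ A, f n ^ 2 := by
    have h1 : S ^ 2 * ((A.filter (fun n => ∀ r ∈ 𝓡, Nat.Coprime n r)).card : ℝ)
        = ∑ n ∈ A with (∀ r ∈ 𝓡, Nat.Coprime n r), f n ^ 2 := by
      rw [Finset.sum_congr rfl (fun n hn => by rw [hf n (Finset.mem_filter.1 hn).2]),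
        Finset.sum_const, nsmul_eq_mul, mul_comm]
    rw [h1]
    exact Finset.sum_le_sum_of_subset_of_nonneg (Finset.filter_subset _ _) fun _ _ _ => sq_nonneg _
  have hexp : ∑ n ∈ A, f n ^ 2 = ∑ x ∈ P, ∑ y ∈ P, c x * c y *
      ((A.filter (fun n => Nat.lcm x.2 y.2 ∣ n)).card : ℝ) := by
    have h1 : ∀ n, f n ^ 2 = ∑ x ∈ P, ∑ y ∈ P, c x * c y *
        (if Nat.lcm x.2 y.2 ∣ n then 1 else 0) := by
      intro n
      rw [sq, Finset.sum_mul_sum]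
      refine Finset.sum_congr rfl fun x _ => Finset.sum_congr rfl fun y _ => ?_
      by_cases h2 : x.2 ∣ n <;> by_cases h3 : y.2 ∣ n <;> simp [h2, h3, Nat.lcm_dvd_iff]
    simp_rw [h1]
    rw [Finset.sum_comm]
    refine Finset.sum_congr rfl fun x _ => ?_
    rw [Finset.sum_comm]
    refine Finset.sum_congr rfl fun y _ => ?_
    rw [← Finset.mul_sum, Finset.sum_boole]
  have hcount : ∀ x ∈ P, ∀ y ∈ P, c x * c y *
      ((A.filter (fun n => Nat.lcm x.2 y.2 ∣ n)).card : ℝ)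
      ≤ c x * c y * (X / Nat.lcm x.2 y.2) + |c x| * |c y| := by
    intro x hx y hy
    obtain ⟨hx1, hx2⟩ := Finset.mem_sigma.1 hx
    obtain ⟨hy1, hy2⟩ := Finset.mem_sigma.1 hy
    have h := hA x.1 hx1 y.1 hy1 x.2 hx2 y.2 hy2
    have h2 : c x * c y * (((A.filter (fun n => Nat.lcm x.2 y.2 ∣ n)).card : ℝ)
        - X / Nat.lcm x.2 y.2) ≤ |c x| * |c y| := by
      refine (le_abs_self _).trans ?_
      rw [abs_mul, abs_mul]
      exact mul_le_of_le_one_right (by positivity) h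
    linarith
  have hmain : ∑ x ∈ P, ∑ y ∈ P, c x * c y * (X / Nat.lcm x.2 y.2) = X * S := by
    simp only [P, Finset.sum_sigma, c]
    have h1 : ∀ r ∈ 𝓡, ∀ s ∈ 𝓡, ∑ d ∈ r.divisors, ∑ e ∈ s.divisors,
        1 / (r.totient : ℝ) * (ArithmeticFunction.moebius d * d) *
        (1 / (s.totient : ℝ) * (ArithmeticFunction.moebius e * e)) * (X / Nat.lcm d e)
        = if r = s then X * (1 / (r.totient : ℝ)) else 0 := by
      intro r hr s hs
      have h2 : ∀ d ∈ r.divisors, ∀ e ∈ s.divisors,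
          1 / (r.totient : ℝ) * (ArithmeticFunction.moebius d * d) *
          (1 / (s.totient : ℝ) * (ArithmeticFunction.moebius e * e)) * (X / Nat.lcm d e)
          = X * (1 / (r.totient : ℝ)) * (1 / (s.totient : ℝ)) *
          ((ArithmeticFunction.moebius d : ℝ) * ArithmeticFunction.moebius e * Nat.gcd d e) := by
        intro d hd e he
        have hd0 := Nat.pos_of_mem_divisors hd
        have he0 := Nat.pos_of_mem_divisors he
        have hl0 : (Nat.lcm d e : ℝ) ≠ 0 := by exact_mod_cast (Nat.lcm_pos hd0 he0).ne'
        have hg : (d : ℝ) * e = Nat.gcd d e * Nat.lcm d e := by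
          exact_mod_cast (Nat.gcd_mul_lcm d e).symm
        have h3 : (d : ℝ) * e / Nat.lcm d e = Nat.gcd d e := by
          rw [hg]; field_simp
        rw [← h3]
        ring
      rw [Finset.sum_congr rfl fun d hd => Finset.sum_congr rfl fun e he => h2 d hd e he]
      simp_rw [← Finset.mul_sum]
      rw [sum_moebius_mul_gcd (h𝓡 r hr).1 (h𝓡 s hs).1]
      by_cases h : r = s
      · subst h
        have : (r.totient : ℝ) ≠ 0 := by exact_mod_cast (Nat.totient_pos.2 (hpos r hr)).ne'
        rw [if_pos rfl, if_pos rfl]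
        field_simp
      · rw [if_neg h, if_neg h, mul_zero]
    rw [hS, Finset.mul_sum]
    refine Finset.sum_congr rfl fun r hr => ?_
    rw [Finset.sum_comm, Finset.sum_congr rfl fun s hs => h1 r hr s hs,
      Finset.sum_ite_eq, if_pos hr]
  -- A crude bound: at most `R` moduli, at most `R` divisors each, every coefficient at most `R`. It
  -- suffices because `R` will be a small power of the interval length.
  have habs : ∑ x ∈ P, |c x| ≤ (R : ℝ) ^ 3 := by
    simp only [P, Finset.sum_sigma, c]
    have h1 : ∀ r ∈ 𝓡, ∑ d ∈ r.divisors,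
        |1 / (r.totient : ℝ) * (ArithmeticFunction.moebius d * d)| ≤ (R : ℝ) ^ 2 := by
      intro r hr
      have hr0 := hpos r hr
      have h2 : ∀ d ∈ r.divisors,
          |1 / (r.totient : ℝ) * (ArithmeticFunction.moebius d * d)| ≤ R := by
        intro d hd
        have h3 : |(ArithmeticFunction.moebius d : ℝ)| ≤ 1 := by
          exact_mod_cast ArithmeticFunction.abs_moebius_le_one
        have h4 : (d : ℝ) ≤ R := by
          exact_mod_cast (Nat.divisor_le hd).trans (h𝓡 r hr).2
        have h5 : |1 / (r.totient : ℝ)| ≤ 1 := by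
          rw [abs_of_nonneg (by positivity), div_le_one (by exact_mod_cast Nat.totient_pos.2 hr0)]
          exact_mod_cast Nat.totient_pos.2 hr0
        rw [abs_mul, abs_mul, abs_of_nonneg (Nat.cast_nonneg d : (0 : ℝ) ≤ d)]
        calc _ ≤ 1 * (1 * (R : ℝ)) := by gcongr
          _ = R := by ring
      refine (Finset.sum_le_card_nsmul _ _ _ h2).trans ?_
      rw [nsmul_eq_mul, sq]
      have : (r.divisors.card : ℝ) ≤ R := by
        exact_mod_cast (Nat.card_divisors_le_self r).trans (h𝓡 r hr).2
      gcongr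
    refine (Finset.sum_le_card_nsmul _ _ _ h1).trans ?_
    have h2 : 𝓡.card ≤ R := by
      have : 𝓡 ⊆ Finset.Icc 1 R := fun r hr => Finset.mem_Icc.2 ⟨hpos r hr, (h𝓡 r hr).2⟩
      simpa using Finset.card_le_card this
    have h3 : (𝓡.card : ℝ) ≤ R := by exact_mod_cast h2
    rw [nsmul_eq_mul, pow_succ' (R : ℝ) 2]
    gcongr
  refine hlow.trans ?_
  rw [hexp]
  refine (Finset.sum_le_sum fun x hx => Finset.sum_le_sum fun y hy => hcount x hx y hy).trans ?_
  simp_rw [Finset.sum_add_distrib]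
  rw [hmain, ← Finset.sum_mul_sum, ← sq]
  gcongr

theorem exists_factored_mul_coprime {q : ℕ} (hq : q ≠ 0) (n : ℕ) (hn : n ≠ 0) :
    ∃ g m : ℕ, g * m = n ∧ g ∈ Nat.factoredNumbers q.primeFactors ∧ m.Coprime q := by
  induction n using Nat.strong_induction_on with
  | _ n ih =>
    by_cases h : n.Coprime q
    · exact ⟨1, n, one_mul n, by simp [Nat.mem_factoredNumbers], h⟩
    · obtain ⟨p, hp, hpn, hpq⟩ := Nat.Prime.not_coprime_iff_dvd.1 h
      obtain ⟨k, rfl⟩ := hpn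
      have hk : k ≠ 0 := by rintro rfl; simp at hn
      obtain ⟨g, m, hgm, hg, hm⟩ := ih k
        (lt_mul_of_one_lt_left (Nat.pos_of_ne_zero hk) hp.one_lt) hk
      refine ⟨p * g, m, by rw [mul_assoc, hgm], ?_, hm⟩
      refine Nat.mul_mem_factoredNumbers ?_ hg
      refine Nat.mem_factoredNumbers_of_primeFactors_subset hp.ne_zero ?_
      rw [hp.primeFactors, Finset.singleton_subset_iff]
      exact Nat.mem_primeFactors.2 ⟨hp, hpq, hq⟩

/-- The full series is the Euler product of `(1 - 1/p)⁻¹` over `p ∣ q`. -/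
theorem sum_inv_factoredNumbers_le {q : ℕ} (hq : q ≠ 0) {s : Finset ℕ}
    (hs : ∀ g ∈ s, g ∈ Nat.factoredNumbers q.primeFactors) :
    ∑ g ∈ s, (g : ℝ)⁻¹ ≤ q / q.totient := by
  let f : ℕ →* ℝ := (invMonoidHom : ℝ →* ℝ).comp (Nat.castRingHom ℝ : ℕ →* ℝ)
  have hf : ∀ n : ℕ, f n = (n : ℝ)⁻¹ := fun n => rfl
  have h := (EulerProduct.summable_and_hasSum_factoredNumbers_prod_filter_prime_geometric (f := f)
    (fun {p} hp => by
      rw [hf, norm_inv, Real.norm_natCast]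
      exact inv_lt_one_of_one_lt₀ (by exact_mod_cast hp.one_lt)) q.primeFactors).2
  have h1 : ∏ p ∈ q.primeFactors with p.Prime, (1 - f p)⁻¹ = q / q.totient := by
    rw [Finset.filter_true_of_mem fun p hp => Nat.prime_of_mem_primeFactors hp,
      Finset.prod_inv_distrib]
    have ht : (q.totient : ℝ) = q * ∏ p ∈ q.primeFactors, (1 - f p) := by
      simp_rw [hf]
      have := congrArg (Rat.cast : ℚ → ℝ) (Nat.totient_eq_mul_prod_factors q)
      push_cast at this
      exact this
    have hq' : (q : ℝ) ≠ 0 := by exact_mod_cast hq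
    rw [ht, div_mul_eq_div_div, div_self hq', one_div]
  rw [h1] at h
  let t : Finset (Nat.factoredNumbers q.primeFactors) :=
    s.attach.map ⟨fun g => ⟨g.1, hs g.1 g.2⟩, fun a b hab => Subtype.ext (congrArg (fun x => x.1) hab)⟩
  have h2 := sum_le_hasSum t (fun i _ => by rw [hf]; positivity) h
  rw [Finset.sum_map] at h2
  exact (Finset.sum_attach s fun g => (g : ℝ)⁻¹).symm.trans_le h2

/-- The moduli of the sieve. -/
def sieveModuli (q R : ℕ) : Finset ℕ :=
  (Finset.Icc 1 R).filter fun r => Squarefree r ∧ r.Coprime q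

/-- Each `n ≤ R` factors as `g b^2 r`, with `g` built from primes of `q` and `r` squarefree and
prime to `q`. The harmonic sum is thus at most a product of three sums; the factor `q/φ(q)` from `g`
later turns density `1/q` into `1/φ(q)`. -/
theorem log_le_mul_sum_sieveModuli {q : ℕ} (hq : q ≠ 0) (R : ℕ) :
    Real.log R ≤ (∑' l : ℕ, 1 / (l : ℝ) ^ 2) * (q / q.totient) *
      ∑ r ∈ sieveModuli q R, 1 / (r.totient : ℝ) := by
  classical
  have h1 : Real.log R ≤ ∑ n ∈ Finset.Icc 1 R, (n : ℝ)⁻¹ := by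
    rcases Nat.eq_zero_or_pos R with rfl | hR
    · simp
    have h := log_add_one_le_harmonic R
    rw [harmonic_eq_sum_Icc] at h
    push_cast at h
    refine (Real.log_le_log (by exact_mod_cast hR) ?_).trans h
    linarith
  have hdec : ∀ n : ℕ, ∃ x : ℕ × ℕ × ℕ, n ≠ 0 → x.1 * (x.2.1 ^ 2 * x.2.2) = n ∧
      x.1 ∈ Nat.factoredNumbers q.primeFactors ∧ Squarefree x.2.2 ∧ x.2.2.Coprime q := by
    intro n
    by_cases hn : n = 0
    · exact ⟨0, fun h => absurd hn h⟩
    obtain ⟨g, m, hgm, hg, hm⟩ := exists_factored_mul_coprime hq n hn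
    obtain ⟨a, b, hab, ha⟩ := Nat.sq_mul_squarefree m
    exact ⟨(g, b, a), fun _ => ⟨by simp only [hab, hgm], hg, ha,
      Nat.Coprime.coprime_dvd_left (Dvd.intro_left _ hab) hm⟩⟩
  choose e he using hdec
  set G := (Finset.Icc 1 R).filter fun g => g ∈ Nat.factoredNumbers q.primeFactors
  let w : ℕ × ℕ × ℕ → ℝ := fun x => (x.1 : ℝ)⁻¹ * (1 / (x.2.1 : ℝ) ^ 2 * (1 / (x.2.2.totient : ℝ)))
  have h2 : ∑ n ∈ Finset.Icc 1 R, (n : ℝ)⁻¹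
      ≤ ∑ x ∈ G ×ˢ (Finset.Icc 1 R ×ˢ sieveModuli q R), w x := by
    calc _ ≤ ∑ n ∈ Finset.Icc 1 R, w (e n) := by
          refine Finset.sum_le_sum fun n hn => ?_
          have hn0 : n ≠ 0 := by have := (Finset.mem_Icc.1 hn).1; omega
          obtain ⟨h3, -, h5, -⟩ := he n hn0
          have h4 : (1 : ℝ) / (e n).2.2 ≤ 1 / ((e n).2.2.totient : ℝ) := by
            refine one_div_le_one_div_of_le ?_ (by exact_mod_cast Nat.totient_le _)
            exact_mod_cast Nat.totient_pos.2 (Nat.pos_of_ne_zero h5.ne_zero)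
          have h6 : (n : ℝ)⁻¹ = ((e n).1 : ℝ)⁻¹ * (1 / ((e n).2.1 : ℝ) ^ 2 * (1 / ((e n).2.2 : ℝ))) := by
            conv_lhs => rw [← h3]
            push_cast
            simp only [mul_inv, one_div]
          rw [h6]
          simp only [w]
          gcongr
      _ = ∑ x ∈ (Finset.Icc 1 R).image e, w x := by
          refine (Finset.sum_image fun a ha b hb hab => ?_).symm
          have ha0 : a ≠ 0 := by have := (Finset.mem_Icc.1 ha).1; omega
          have hb0 : b ≠ 0 := by have := (Finset.mem_Icc.1 hb).1; omega
          rw [← (he a ha0).1, ← (he b hb0).1, hab]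
      _ ≤ _ := by
          refine Finset.sum_le_sum_of_subset_of_nonneg ?_ fun _ _ _ => by positivity
          intro x hx
          obtain ⟨n, hn, rfl⟩ := Finset.mem_image.1 hx
          obtain ⟨hn1, hnR⟩ := Finset.mem_Icc.1 hn
          obtain ⟨h3, h4, h5, h6⟩ := he n (by omega)
          have d1 : (e n).1 ∣ n := Dvd.intro _ h3
          have d2 : (e n).2.1 ∣ n :=
            (Dvd.dvd.mul_left (Dvd.dvd.mul_right (dvd_pow_self _ two_ne_zero) _) _).trans h3.dvd
          have d3 : (e n).2.2 ∣ n := (Dvd.dvd.mul_left (dvd_mul_left _ _) _).trans h3.dvd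
          have aux : ∀ k, k ∣ n → k ∈ Finset.Icc 1 R := fun k hk =>
            Finset.mem_Icc.2 ⟨Nat.pos_of_dvd_of_pos hk hn1, (Nat.le_of_dvd hn1 hk).trans hnR⟩
          simp only [Finset.mem_product, G, sieveModuli, Finset.mem_filter]
          exact ⟨⟨aux _ d1, h4⟩, aux _ d2, aux _ d3, h5, h6⟩
  have h3 : ∑ x ∈ G ×ˢ (Finset.Icc 1 R ×ˢ sieveModuli q R), w x
      = (∑ g ∈ G, (g : ℝ)⁻¹) * ((∑ l ∈ Finset.Icc 1 R, 1 / (l : ℝ) ^ 2) *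
        ∑ r ∈ sieveModuli q R, 1 / (r.totient : ℝ)) := by
    rw [Finset.sum_mul_sum (Finset.Icc 1 R), ← Finset.sum_product', Finset.sum_mul_sum,
      ← Finset.sum_product']
  have h4 : ∑ l ∈ Finset.Icc 1 R, 1 / (l : ℝ) ^ 2 ≤ ∑' l : ℕ, 1 / (l : ℝ) ^ 2 :=
    (Real.summable_one_div_nat_pow.2 one_lt_two).sum_le_tsum _ fun _ _ => by positivity
  have h5 : ∑ g ∈ G, (g : ℝ)⁻¹ ≤ q / q.totient :=
    sum_inv_factoredNumbers_le hq fun g hg => (Finset.mem_filter.1 hg).2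
  refine h1.trans (h2.trans ?_)
  rw [h3, mul_comm (∑' l : ℕ, 1 / (l : ℝ) ^ 2), mul_assoc]
  gcongr

/-- The Chinese remainder theorem merges both conditions into one class modulo `q * D`, whose count
is a difference of two ceilings. -/
theorem abs_card_Ico_modEq_dvd_sub_le {q D : ℕ} (hq : 0 < q) (hD : 0 < D) (h : q.Coprime D)
    (a N : ℕ) :
    |((((Finset.Ico N (2 * N)).filter (fun n => n ≡ a [MOD q])).filter
      (fun n => D ∣ n)).card : ℝ) - (N : ℝ) / q / D| ≤ 1 := by
  obtain ⟨c, hc1, hc2⟩ := Nat.chineseRemainder h a 0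
  have e : ((Finset.Ico N (2 * N)).filter (fun n => n ≡ a [MOD q])).filter (fun n => D ∣ n)
      = (Finset.Ico N (2 * N)).filter (fun n => n ≡ c [MOD q * D]) := by
    rw [Finset.filter_filter]
    refine Finset.filter_congr fun n _ => ?_
    rw [← Nat.modEq_and_modEq_iff_modEq_mul h, ← Nat.modEq_zero_iff_dvd]
    exact ⟨fun h => ⟨h.1.trans hc1.symm, h.2.trans hc2.symm⟩,
      fun h => ⟨h.1.trans hc1, h.2.trans hc2⟩⟩
  have hr : 0 < q * D := Nat.mul_pos hq hD
  have hcard := Nat.Ico_filter_modEq_card N (2 * N) hr c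
  rw [e]
  set k := ((Finset.Ico N (2 * N)).filter (fun n => n ≡ c [MOD q * D])).card
  have hr' : (0 : ℚ) < ((q * D : ℕ) : ℚ) := by exact_mod_cast hr
  set u : ℚ := (((2 * N : ℕ) : ℚ) - c) / ((q * D : ℕ) : ℚ)
  set v : ℚ := ((N : ℚ) - c) / ((q * D : ℕ) : ℚ)
  have huv : u - v = (N : ℚ) / q / D := by
    simp only [u, v]
    push_cast
    rw [← sub_div, div_div]
    congr 1
    ring
  have huv0 : v ≤ u := by
    rw [← sub_nonneg, huv]
    positivity
  have hmax : (k : ℤ) = ⌈u⌉ - ⌈v⌉ := by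
    rw [hcard, max_eq_left]
    exact sub_nonneg.2 (Int.ceil_mono huv0)
  have hQ : |(k : ℚ) - (N : ℚ) / q / D| ≤ 1 := by
    have h1 : (k : ℚ) = (⌈u⌉ : ℚ) - ⌈v⌉ := by exact_mod_cast hmax
    have := Int.le_ceil u
    have := Int.le_ceil v
    have := Int.ceil_lt_add_one u
    have := Int.ceil_lt_add_one v
    rw [h1, ← huv, abs_le]
    constructor <;> linarith
  have := (Rat.cast_le (K := ℝ)).2 hQ
  push_cast at this
  exact this

/-- Division of the sieve inequality by `S^2`; `S ≥ 1` keeps the error below `E`. -/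
theorem le_of_sq_mul_le {Z S N q φ L K E : ℝ} (hS : 1 ≤ S) (hN : 0 ≤ N) (hq : 0 < q) (hφ : 0 < φ)
    (hL : 0 < L) (hE : 0 ≤ E) (h : S ^ 2 * Z ≤ N / q * S + E) (hLS : L ≤ K * (q / φ) * S) :
    Z ≤ K * N / (φ * L) + E := by
  have hS0 : 0 < S := by linarith
  have h1 : Z ≤ N / q / S + E := by
    have h2 : Z ≤ (N / q * S + E) / S ^ 2 := by
      rw [le_div_iff₀ (by positivity)]
      linarith
    refine h2.trans ?_
    rw [add_div]
    have h3 : N / q * S / S ^ 2 = N / q / S := by field_simp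
    rw [h3]
    have h4 : E / S ^ 2 ≤ E := div_le_self hE (one_le_pow₀ hS)
    linarith
  refine h1.trans ?_
  have h2 : N / q / S ≤ K * N / (φ * L) := by
    rw [div_div, div_le_div_iff₀ (by positivity) (by positivity)]
    have h3 : φ * L ≤ K * (q * S) := by
      calc _ ≤ φ * (K * (q / φ) * S) := by gcongr
        _ = K * (q * S) := by field_simp
    calc N * (φ * L) ≤ N * (K * (q * S)) := by gcongr
      _ = _ := by ring
  linarith

/-- A **Brun–Titchmarsh** bound for dyadic intervals. -/
theorem card_primes_Ico_modEq_le {q : ℕ} (hq : 0 < q) (a : ℕ) {R N : ℕ} (hR : 2 ≤ R) (hRN : R < N) :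
    (((Finset.Ico N (2 * N)).filter (fun p => p.Prime ∧ p ≡ a [MOD q])).card : ℝ)
      ≤ (∑' l : ℕ, 1 / (l : ℝ) ^ 2) * N / (q.totient * Real.log R) + (R : ℝ) ^ 6 := by
  have hmem : ∀ r ∈ sieveModuli q R, 1 ≤ r ∧ r ≤ R ∧ Squarefree r ∧ r.Coprime q := fun r hr => by
    simpa [sieveModuli, and_assoc] using hr
  have hsieve := selberg_sieve_bound ((Finset.Ico N (2 * N)).filter (fun n => n ≡ a [MOD q]))
    (sieveModuli q R) (X := (N : ℝ) / q) R
    (fun r hr => ⟨(hmem r hr).2.2.1, (hmem r hr).2.1⟩)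
    (fun r hr s hs d hd e he => abs_card_Ico_modEq_dvd_sub_le hq
      (Nat.lcm_pos (Nat.pos_of_mem_divisors hd) (Nat.pos_of_mem_divisors he))
      (Nat.Coprime.symm (Nat.Coprime.coprime_dvd_left (Nat.lcm_dvd_mul d e) (Nat.Coprime.mul_left
        ((hmem r hr).2.2.2.coprime_dvd_left (Nat.dvd_of_mem_divisors hd))
        ((hmem s hs).2.2.2.coprime_dvd_left (Nat.dvd_of_mem_divisors he))))) a N)
  have hS1 : 1 ≤ ∑ r ∈ sieveModuli q R, 1 / (r.totient : ℝ) := by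
    have h1 : 1 ∈ sieveModuli q R := by simp [sieveModuli]; omega
    have := Finset.single_le_sum (f := fun r : ℕ => 1 / (r.totient : ℝ))
      (fun _ _ => by positivity) h1
    simpa using this
  have hsub : (Finset.Ico N (2 * N)).filter (fun p => p.Prime ∧ p ≡ a [MOD q])
      ⊆ ((Finset.Ico N (2 * N)).filter (fun n => n ≡ a [MOD q])).filter
        (fun n => ∀ r ∈ sieveModuli q R, Nat.Coprime n r) := by
    intro p hp
    simp only [Finset.mem_filter] at hp ⊢
    refine ⟨⟨hp.1, hp.2.2⟩, fun r hr => ?_⟩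
    rw [hp.2.1.coprime_iff_not_dvd]
    intro hdvd
    have h1 := Nat.le_of_dvd (hmem r hr).1 hdvd
    have h2 := (hmem r hr).2.1
    have h3 := (Finset.mem_Ico.1 hp.1).1
    omega
  refine (Nat.cast_le.2 (Finset.card_le_card hsub)).trans ?_
  rw [← pow_mul] at hsieve
  exact le_of_sq_mul_le hS1 (Nat.cast_nonneg N) (by exact_mod_cast hq)
    (by exact_mod_cast Nat.totient_pos.2 hq) (Real.log_pos (by exact_mod_cast hR)) (by positivity)
    hsieve (log_le_mul_sum_sieveModuli hq.ne' R)

/-! ### Reciprocals of primes in a residue class. -/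

/-- Sieve with `R = 2^⌊j/12⌋`, so that `log R` has order `j`. From `R^6 ≤ 2^(j/2)`, `q ≤ 2^(j/4)`
and `j ≤ 4 * 2^(j/4)`, the sieve error is at most `4 * 2^j / (q j)`, comparable to the main term;
fourth powers keep this in `ℕ`. -/
theorem exists_sum_inv_primes_dyadic_le : ∃ C : ℝ, 0 < C ∧ ∀ (q : ℕ), 0 < q → ∀ a j : ℕ, 12 ≤ j →
    q ^ 4 ≤ 2 ^ j →
    ∑ p ∈ Finset.Ico (2 ^ j) (2 ^ (j + 1)) with p.Prime ∧ p ≡ a [MOD q], 1 / (p : ℝ)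
      ≤ C / (q.totient * j) := by
  set Kz := ∑' l : ℕ, 1 / (l : ℝ) ^ 2 with hKz
  have hKz0 : 0 ≤ Kz := tsum_nonneg fun _ => by positivity
  have hlog2 : 0 < Real.log 2 := Real.log_pos one_lt_two
  refine ⟨24 * Kz / Real.log 2 + 4, by positivity, fun q hq a j hj hqj => ?_⟩
  set R := 2 ^ (j / 12) with hR
  have hk : 1 ≤ j / 12 := by omega
  have hR2 : 2 ≤ R := by simpa [hR] using Nat.pow_le_pow_right (n := 2) two_pos hk
  have hRN : R < 2 ^ j := Nat.pow_lt_pow_right one_lt_two (by omega)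
  have hcard := card_primes_Ico_modEq_le hq a hR2 hRN
  rw [← hKz] at hcard
  have hq' : (0 : ℝ) < q := by exact_mod_cast hq
  have hφ : (0 : ℝ) < q.totient := by exact_mod_cast Nat.totient_pos.2 hq
  have hj0 : (0 : ℝ) < j := by exact_mod_cast (by omega : 0 < j)
  have hN : (0 : ℝ) < 2 ^ j := by positivity
  have hlogR : (j : ℝ) / 24 * Real.log 2 ≤ Real.log R := by
    rw [hR]
    push_cast
    rw [Real.log_pow]
    have : (j : ℝ) ≤ 24 * ((j / 12 : ℕ) : ℝ) := by exact_mod_cast (by omega : j ≤ 24 * (j / 12))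
    gcongr
    linarith
  have hR6 : (R : ℝ) ^ 6 * (q * j) ≤ 4 * 2 ^ j := by
    have hj4 : j ^ 4 ≤ 256 * 2 ^ j := by
      have h1 : j / 4 + 1 ≤ 2 ^ (j / 4) := Nat.lt_two_pow_self
      have h2 : j ≤ 4 * 2 ^ (j / 4) := by omega
      calc j ^ 4 ≤ (4 * 2 ^ (j / 4)) ^ 4 := Nat.pow_le_pow_left h2 4
        _ = 256 * 2 ^ (j / 4 * 4) := by rw [mul_pow, ← pow_mul]; norm_num
        _ ≤ 256 * 2 ^ j := by
          gcongr
          · norm_num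
          · omega
    have hR12 : R ^ 12 ≤ 2 ^ j := by
      rw [hR, ← pow_mul]
      exact Nat.pow_le_pow_right two_pos (by omega)
    have h : (R ^ 6 * (q * j)) ^ 4 ≤ (4 * 2 ^ j) ^ 4 := by
      calc (R ^ 6 * (q * j)) ^ 4 = R ^ 12 * R ^ 12 * q ^ 4 * j ^ 4 := by ring
        _ ≤ 2 ^ j * 2 ^ j * 2 ^ j * (256 * 2 ^ j) := by gcongr
        _ = (4 * 2 ^ j) ^ 4 := by ring
    exact_mod_cast (Nat.pow_le_pow_iff_left (by norm_num)).1 h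
  have hφq : (q.totient : ℝ) ≤ q := by exact_mod_cast Nat.totient_le q
  have hpow : (2 : ℕ) ^ (j + 1) = 2 * 2 ^ j := by ring
  rw [hpow]
  have h1 : ∑ p ∈ Finset.Ico (2 ^ j) (2 * 2 ^ j) with p.Prime ∧ p ≡ a [MOD q], 1 / (p : ℝ)
      ≤ (((Finset.Ico (2 ^ j) (2 * 2 ^ j)).filter
        (fun p => p.Prime ∧ p ≡ a [MOD q])).card : ℝ) * (1 / 2 ^ j) := by
    rw [← nsmul_eq_mul]
    refine Finset.sum_le_card_nsmul _ _ _ fun p hp => ?_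
    have : 2 ^ j ≤ p := (Finset.mem_Ico.1 (Finset.mem_filter.1 hp).1).1
    refine one_div_le_one_div_of_le hN ?_
    exact_mod_cast this
  refine h1.trans ((mul_le_mul_of_nonneg_right hcard (by positivity)).trans ?_)
  push_cast
  have h2 : Kz * 2 ^ j / (q.totient * Real.log R) ≤
      Kz * 2 ^ j / (q.totient * (j / 24 * Real.log 2)) := by
    gcongr
  have h3 : (R : ℝ) ^ 6 ≤ 4 * 2 ^ j / (q.totient * j) := by
    rw [le_div_iff₀ (by positivity)]
    refine le_trans ?_ hR6
    gcongr
  calc (Kz * 2 ^ j / (q.totient * Real.log R) + (R : ℝ) ^ 6) * (1 / 2 ^ j)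
      ≤ (Kz * 2 ^ j / (q.totient * (j / 24 * Real.log 2)) + 4 * 2 ^ j / (q.totient * j))
        * (1 / 2 ^ j) := by gcongr
    _ = _ := by field_simp

/-- Within one class `n ↦ n / q` is injective, and `1/n ≤ 1/(q ⌊n/q⌋)`. -/
theorem sum_inv_modEq_le {q : ℕ} (hq : 0 < q) (a N : ℕ) :
    ∑ n ∈ Finset.range N with q < n ∧ n ≡ a [MOD q], 1 / (n : ℝ)
      ≤ (∑ k ∈ Finset.Icc 1 N, (k : ℝ)⁻¹) / q := by
  have hq' : (0 : ℝ) < q := by exact_mod_cast hq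
  set s := (Finset.range N).filter fun n => q < n ∧ n ≡ a [MOD q] with hs
  have hmem : ∀ n ∈ s, n < N ∧ q < n ∧ n ≡ a [MOD q] := fun n hn => by simpa [hs] using hn
  have hdiv : ∀ n ∈ s, 1 ≤ n / q := fun n hn =>
    (Nat.one_le_div_iff hq).2 (hmem n hn).2.1.le
  calc ∑ n ∈ s, 1 / (n : ℝ) ≤ ∑ n ∈ s, ((n / q : ℕ) : ℝ)⁻¹ / q := by
        refine Finset.sum_le_sum fun n hn => ?_
        have h1 : (0 : ℝ) < (n / q : ℕ) := by exact_mod_cast hdiv n hn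
        have h2 : ((n / q : ℕ) : ℝ) * q ≤ n := by exact_mod_cast Nat.div_mul_le_self n q
        rw [inv_eq_one_div, div_div]
        exact one_div_le_one_div_of_le (by positivity) h2
    _ = (∑ k ∈ s.image (fun n => n / q), (k : ℝ)⁻¹) / q := by
        rw [Finset.sum_image, Finset.sum_div]
        intro m hm n hn hmn
        have h1 : m % q = n % q := (hmem m hm).2.2.trans (hmem n hn).2.2.symm
        have h2 : m / q = n / q := hmn
        rw [← Nat.div_add_mod m q, ← Nat.div_add_mod n q, h1, h2]
    _ ≤ _ := by
        gcongr
        intro k hk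
        obtain ⟨n, hn, rfl⟩ := Finset.mem_image.1 hk
        exact Finset.mem_Icc.2 ⟨hdiv n hn, (Nat.div_le_self n q).trans (hmem n hn).1.le⟩

theorem sum_inv_Icc_le (N : ℕ) : ∑ k ∈ Finset.Icc 1 N, (k : ℝ)⁻¹ ≤ 1 + Real.log N := by
  have h := harmonic_le_one_add_log N
  rw [harmonic_eq_sum_Icc] at h
  push_cast at h
  exact h

/-- The primes `q < p < 2^J` of a residue class modulo `q` contribute `O((log 2q + log (J+1))/φ(q))`
to `∑ 1/p`. -/
theorem exists_sum_inv_primes_le : ∃ C : ℝ, 0 < C ∧ ∀ (q : ℕ), 0 < q → ∀ a J : ℕ,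
    ∑ p ∈ Finset.range (2 ^ J) with p.Prime ∧ q < p ∧ p ≡ a [MOD q], 1 / (p : ℝ)
      ≤ C * (Real.log (2 * q) + Real.log (J + 1)) / q.totient := by
  obtain ⟨C, hC0, hC⟩ := exists_sum_inv_primes_dyadic_le
  refine ⟨18 + 2 * C, by positivity, fun q hq a J => ?_⟩
  have hq' : (0 : ℝ) < q := by exact_mod_cast hq
  have hq1 : (1 : ℝ) ≤ q := by exact_mod_cast hq
  have hφ : (0 : ℝ) < q.totient := by exact_mod_cast Nat.totient_pos.2 hq
  have hφq : (q.totient : ℝ) ≤ q := by exact_mod_cast Nat.totient_le q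
  have hlog2 := Real.log_two_gt_d9
  set Λ := Real.log (2 * q) with hΛ
  have hΛ2 : Real.log 2 ≤ Λ := Real.log_le_log two_pos (by linarith)
  -- Below `2^j0` all integers of the class may be counted, as `log (2^j0) = O(log 2q)`. From `j0`
  -- on, `12 ≤ j` and `q^4 ≤ 2^j` allow the dyadic bound, and the sum of `1/j` gives `log (J + 1)`.
  set j0 := 12 + 4 * Nat.clog 2 q with hj0
  have hqj0 : q ^ 4 ≤ 2 ^ j0 := by
    calc q ^ 4 ≤ (2 ^ Nat.clog 2 q) ^ 4 := Nat.pow_le_pow_left (Nat.le_pow_clog one_lt_two q) 4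
      _ = 2 ^ (4 * Nat.clog 2 q) := by rw [← pow_mul, mul_comm]
      _ ≤ 2 ^ j0 := Nat.pow_le_pow_right two_pos (by omega)
  have hj0log : (j0 : ℝ) * Real.log 2 ≤ 16 * Λ := by
    have h1 : (Nat.clog 2 q : ℝ) * Real.log 2 ≤ Λ := by
      rcases Nat.lt_or_ge 1 q with h | h
      · have h2 := Nat.pow_pred_clog_lt_self one_lt_two h
        have h3 : 2 ^ Nat.clog 2 q ≤ 2 * q := by
          have h4 : 0 < Nat.clog 2 q := Nat.clog_pos one_lt_two h
          obtain ⟨k, hk⟩ := Nat.exists_eq_succ_of_ne_zero h4.ne'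
          rw [hk] at h2 ⊢
          rw [Nat.pow_succ]
          simp only [Nat.succ_eq_add_one, Nat.pred_succ] at h2
          omega
        rw [← Real.log_pow]
        exact Real.log_le_log (by positivity) (by exact_mod_cast h3)
      · have : q = 1 := by omega
        subst this
        simp
        linarith
    rw [hj0]
    push_cast
    linarith
  set F : ℕ → ℝ := fun J =>
    ∑ p ∈ Finset.range (2 ^ J) with p.Prime ∧ q < p ∧ p ≡ a [MOD q], 1 / (p : ℝ) with hF
  have hmono : ∀ {m n : ℕ}, m ≤ n → F m ≤ F n := by
    intro m n hmn
    refine Finset.sum_le_sum_of_subset_of_nonneg ?_ fun _ _ _ => by positivity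
    exact Finset.filter_subset_filter _
      (Finset.range_mono (Nat.pow_le_pow_right two_pos hmn))
  have hbase : F j0 ≤ 18 * Λ / q.totient := by
    calc F j0 ≤ ∑ n ∈ Finset.range (2 ^ j0) with q < n ∧ n ≡ a [MOD q], 1 / (n : ℝ) := by
          refine Finset.sum_le_sum_of_subset_of_nonneg ?_ fun _ _ _ => by positivity
          exact Finset.monotone_filter_right _ fun p _ hp => hp.2
      _ ≤ (1 + Real.log ((2 ^ j0 : ℕ) : ℝ)) / q := by
          refine (sum_inv_modEq_le hq a _).trans ?_
          gcongr
          exact sum_inv_Icc_le _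
      _ ≤ (18 * Λ) / q := by
          gcongr
          push_cast
          rw [Real.log_pow]
          linarith
      _ ≤ 18 * Λ / q.totient := div_le_div_of_nonneg_left (by linarith) hφ hφq
  have hstep : ∀ j, j0 ≤ j → F (j + 1) ≤ F j + C / q.totient * (j : ℝ)⁻¹ := by
    intro j hj
    have h1 := hC q hq a j (by omega) (hqj0.trans (Nat.pow_le_pow_right two_pos hj))
    have hpow : 2 ^ j ≤ 2 ^ (j + 1) := Nat.pow_le_pow_right two_pos (by omega)
    have h2 : F (j + 1) = F j + ∑ p ∈ Finset.Ico (2 ^ j) (2 ^ (j + 1)) with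
        p.Prime ∧ q < p ∧ p ≡ a [MOD q], 1 / (p : ℝ) := by
      simp only [hF, Finset.sum_filter, Finset.range_eq_Ico]
      rw [Finset.sum_Ico_consecutive _ (Nat.zero_le _) hpow]
    have h3 : ∑ p ∈ Finset.Ico (2 ^ j) (2 ^ (j + 1)) with
        p.Prime ∧ q < p ∧ p ≡ a [MOD q], 1 / (p : ℝ)
        ≤ ∑ p ∈ Finset.Ico (2 ^ j) (2 ^ (j + 1)) with p.Prime ∧ p ≡ a [MOD q], 1 / (p : ℝ) := by
      refine Finset.sum_le_sum_of_subset_of_nonneg ?_ fun _ _ _ => by positivity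
      exact Finset.monotone_filter_right _ fun p _ hp => ⟨hp.1, hp.2.2⟩
    have h4 : C / q.totient * (j : ℝ)⁻¹ = C / (q.totient * j) := by
      rw [← div_eq_mul_inv, div_div]
    linarith
  have hind : ∀ J, j0 ≤ J → F J ≤ F j0 + C / q.totient * ∑ j ∈ Finset.Ico j0 J, (j : ℝ)⁻¹ := by
    intro J hJ
    induction J, hJ using Nat.le_induction with
    | base => simp
    | succ n hn ih =>
      rw [Finset.sum_Ico_succ_top hn, mul_add]
      linarith [hstep n hn]
  have hfin : F J ≤ 18 * Λ / q.totient + C / q.totient * (1 + Real.log (J + 1)) := by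
    have hl0 : 0 ≤ Real.log ((J : ℝ) + 1) := Real.log_nonneg (by linarith [Nat.cast_nonneg (α := ℝ) J])
    rcases le_total J j0 with h | h
    · have : 0 ≤ C / q.totient * (1 + Real.log (J + 1)) := by positivity
      linarith [hmono h]
    · have h1 : ∑ j ∈ Finset.Ico j0 J, (j : ℝ)⁻¹ ≤ 1 + Real.log (J + 1) := by
        have h2 := sum_inv_Icc_le (J + 1)
        push_cast at h2
        refine le_trans (Finset.sum_le_sum_of_subset_of_nonneg ?_ fun _ _ _ => by positivity) h2
        intro k hk
        simp only [Finset.mem_Ico, Finset.mem_Icc] at hk ⊢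
        omega
      have h2 : C / q.totient * ∑ j ∈ Finset.Ico j0 J, (j : ℝ)⁻¹
          ≤ C / q.totient * (1 + Real.log (J + 1)) := by gcongr
      linarith [hind J h]
  refine hfin.trans ?_
  rw [div_mul_eq_mul_div, ← add_div]
  gcongr
  have hl0 : 0 ≤ Real.log ((J : ℝ) + 1) := Real.log_nonneg (by linarith [Nat.cast_nonneg (α := ℝ) J])
  nlinarith

/-! ### Existence of the limit. -/

section LimitExists

variable {q : ℕ} (a : ZMod q)

open Classical in
/-- The indicator function of the primes in a residue class. -/
noncomputable def primeIndicator (n : ℕ) : ℂ := if n ∈ primesInClass a then 1 else 0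

theorem abscissaOfAbsConv_primeIndicator_le : LSeries.abscissaOfAbsConv (primeIndicator a) ≤ 1 := by
  refine LSeries.abscissaOfAbsConv_le_of_le_const ⟨1, fun n _ => ?_⟩
  unfold primeIndicator
  split_ifs <;> simp

theorem primeClassSeries_eq_LSeries (s : ℂ) :
    primeClassSeries a s = LSeries (primeIndicator a) s := by
  rw [primeClassSeries, tsum_subtype (primesInClass a) (fun n : ℕ => 1 / (n : ℂ) ^ s), LSeries]
  refine tsum_congr fun n => ?_
  by_cases h : n ∈ primesInClass a
  · rw [Set.indicator_of_mem h, LSeries.term_of_ne_zero h.1.ne_zero, primeIndicator, if_pos h]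
  · rw [Set.indicator_of_notMem h, LSeries.term_def]
    simp [primeIndicator, h]

theorem hasDerivAt_primeClassSeries {s : ℂ} (hs : 1 < s.re) :
    HasDerivAt (primeClassSeries a) (-LSeries (LSeries.logMul (primeIndicator a)) s) s := by
  have h := LSeries_hasDerivAt (f := primeIndicator a) (s := s)
    ((abscissaOfAbsConv_primeIndicator_le a).trans_lt (by exact_mod_cast hs))
  rwa [← funext (primeClassSeries_eq_LSeries a)] at h

/-- The prime-power part of `∑ Λ(n)/n^s` in a residue class stays bounded up to `Re s = 1`. -/
theorem exists_norm_LSeries_residueClass_sub_le : ∃ B : ℝ, ∀ s : ℂ, 1 < s.re →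
    ‖LSeries (fun n => (ArithmeticFunction.vonMangoldt.residueClass a n : ℂ)) s
      - LSeries (LSeries.logMul (primeIndicator a)) s‖ ≤ B := by
  have hsum := ArithmeticFunction.vonMangoldt.summable_residueClass_non_primes_div a
  refine ⟨∑' n : ℕ, (if n.Prime then 0 else
    ArithmeticFunction.vonMangoldt.residueClass a n) / n, fun s hs => ?_⟩
  have h1 : LSeriesSummable (fun n => (ArithmeticFunction.vonMangoldt.residueClass a n : ℂ)) s :=
    LSeriesSummable_of_abscissaOfAbsConv_lt_re
      ((ArithmeticFunction.vonMangoldt.abscissaOfAbsConv_residueClass_le_one a).trans_lt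
        (by exact_mod_cast hs))
  have h2 : LSeriesSummable (LSeries.logMul (primeIndicator a)) s :=
    LSeriesSummable_logMul_of_lt_re
      ((abscissaOfAbsConv_primeIndicator_le a).trans_lt (by exact_mod_cast hs))
  rw [← LSeries_sub h1 h2]
  refine tsum_of_norm_bounded hsum.hasSum fun n => ?_
  rcases eq_or_ne n 0 with rfl | hn
  · simp
  have hn0 : (0 : ℝ) < n := by exact_mod_cast Nat.pos_of_ne_zero hn
  have hn1 : (1 : ℝ) ≤ n := by exact_mod_cast Nat.pos_of_ne_zero hn
  have hval : ((fun n => (ArithmeticFunction.vonMangoldt.residueClass a n : ℂ))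
      - LSeries.logMul (primeIndicator a)) n
      = ((if n.Prime then 0 else ArithmeticFunction.vonMangoldt.residueClass a n : ℝ) : ℂ) := by
    simp only [Pi.sub_apply, LSeries.logMul, primeIndicator, primesInClass, Set.mem_ofPred_eq,
      ArithmeticFunction.vonMangoldt.residueClass, Set.indicator_apply]
    by_cases hp : n.Prime
    · by_cases hna : (n : ZMod q) = a
      · simp [hp, hna, ArithmeticFunction.vonMangoldt_apply_prime hp, Complex.natCast_log]
      · simp [hp, hna]
    · simp [hp]
  rw [LSeries.term_of_ne_zero hn, hval, norm_div, Complex.norm_natCast_cpow_of_pos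
    (Nat.pos_of_ne_zero hn), Complex.norm_of_nonneg]
  · have h0 := ArithmeticFunction.vonMangoldt.residueClass_nonneg a n
    have h3 : (n : ℝ) ≤ (n : ℝ) ^ s.re := Real.self_le_rpow_of_one_le hn1 hs.le
    have h4 : 0 ≤ (if n.Prime then 0 else ArithmeticFunction.vonMangoldt.residueClass a n : ℝ) := by
      split_ifs
      exacts [le_rfl, h0]
    gcongr
  · split_ifs
    exacts [le_rfl, ArithmeticFunction.vonMangoldt.residueClass_nonneg a n]

theorem tendsto_ofReal_nhdsGT_one :
    Tendsto (fun σ : ℝ => (σ : ℂ)) (𝓝[>] 1) (𝓝[{s : ℂ | 1 < s.re}] 1) := by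
  refine tendsto_nhdsWithin_iff.2 ⟨?_, ?_⟩
  · have h := Complex.continuous_ofReal.tendsto (1 : ℝ)
    rw [Complex.ofReal_one] at h
    exact h.mono_left nhdsWithin_le_nhds
  · filter_upwards [self_mem_nhdsWithin] with σ hσ
    simpa using hσ

/-- A ball meets the half-plane in a convex set, so the mean value inequality makes `F` Lipschitz
there, hence Cauchy at `1`. -/
theorem exists_tendsto_of_bounded_deriv {F F' : ℂ → ℂ} {C : ℝ}
    (hF : ∀ s : ℂ, 1 < s.re → HasDerivAt F (F' s) s)
    (hb : ∀ᶠ s in 𝓝[{s : ℂ | 1 < s.re}] 1, ‖F' s‖ ≤ C) :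
    ∃ L : ℂ, Tendsto F (𝓝[{s : ℂ | 1 < s.re}] 1) (𝓝 L) := by
  have : (𝓝[{s : ℂ | 1 < s.re}] (1 : ℂ)).NeBot := tendsto_ofReal_nhdsGT_one.neBot
  obtain ⟨r, hr, hball⟩ := Metric.mem_nhdsWithin_iff.1 hb
  have hconv : Convex ℝ (Metric.ball (1 : ℂ) r ∩ {s : ℂ | 1 < s.re}) :=
    (convex_ball 1 r).inter (convex_halfSpace_re_gt 1)
  have hlip : ∀ x ∈ Metric.ball (1 : ℂ) r ∩ {s : ℂ | 1 < s.re},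
      ∀ y ∈ Metric.ball (1 : ℂ) r ∩ {s : ℂ | 1 < s.re}, ‖F y - F x‖ ≤ C * ‖y - x‖ :=
    fun x hx y hy => hconv.norm_image_sub_le_of_norm_hasDerivWithin_le
      (fun s hs => (hF s hs.2).hasDerivWithinAt) (fun s hs => hball hs) hx hy
  refine cauchy_map_iff_exists_tendsto.1 (Metric.cauchy_iff.2 ⟨inferInstance, fun ε hε => ?_⟩)
  set δ := min r (ε / (2 * (|C| + 1))) with hδ
  have hδ0 : 0 < δ := lt_min hr (by positivity)
  refine ⟨F '' (Metric.ball 1 δ ∩ {s : ℂ | 1 < s.re}), image_mem_map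
    (Filter.inter_mem (mem_nhdsWithin_of_mem_nhds (Metric.ball_mem_nhds 1 hδ0))
      self_mem_nhdsWithin), ?_⟩
  rintro _ ⟨x, hx, rfl⟩ _ ⟨y, hy, rfl⟩
  have hsub : Metric.ball (1 : ℂ) δ ⊆ Metric.ball 1 r := Metric.ball_subset_ball (min_le_left _ _)
  have h := hlip y ⟨hsub hy.1, hy.2⟩ x ⟨hsub hx.1, hx.2⟩
  rw [dist_eq_norm]
  have hxy : ‖x - y‖ < 2 * δ := by
    rw [← dist_eq_norm]
    have h1 := dist_triangle_right x y 1
    have h2 := Metric.mem_ball.1 hx.1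
    have h3 := Metric.mem_ball.1 hy.1
    linarith
  have h4 : C * ‖x - y‖ ≤ (|C| + 1) * ‖x - y‖ := by
    gcongr
    linarith [le_abs_self C]
  have h5 : (|C| + 1) * ‖x - y‖ < (|C| + 1) * (2 * δ) := by
    have : 0 < |C| + 1 := by positivity
    gcongr
  have h6 : (|C| + 1) * (2 * δ) ≤ ε := by
    have h7 : δ ≤ ε / (2 * (|C| + 1)) := min_le_right _ _
    rw [le_div_iff₀ (by positivity)] at h7
    linarith
  linarith

variable [NeZero q] {a}

/-- Up to the bounded prime-power part, the derivative is minus `LFunctionResidueClassAux`, the von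
Mangoldt series of the class with its pole at `1` removed, which is continuous on `Re s ≥ 1`. -/
theorem exists_tendsto_primeClassSeries_sub (ha : IsUnit a) : ∃ L : ℂ,
    Tendsto (fun s : ℂ => primeClassSeries a s -
      1 / (Nat.totient q : ℂ) * Complex.log (1 / (s - 1))) (𝓝[{s : ℂ | 1 < s.re}] 1) (𝓝 L) := by
  obtain ⟨B, hB⟩ := exists_norm_LSeries_residueClass_sub_le a
  have hcont : Tendsto (ArithmeticFunction.vonMangoldt.LFunctionResidueClassAux a)
      (𝓝[{s : ℂ | 1 < s.re}] 1)
      (𝓝 (ArithmeticFunction.vonMangoldt.LFunctionResidueClassAux a 1)) :=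
    (ArithmeticFunction.vonMangoldt.continuousOn_LFunctionResidueClassAux a 1 (by simp)).mono_left
      (nhdsWithin_mono _ fun s (hs : 1 < s.re) => hs.le)
  refine exists_tendsto_of_bounded_deriv
    (F' := fun s => -LSeries (LSeries.logMul (primeIndicator a)) s -
      1 / (Nat.totient q : ℂ) * (-(1 / (s - 1))))
    (C := ‖ArithmeticFunction.vonMangoldt.LFunctionResidueClassAux a 1‖ + 1 + B) ?_ ?_
  · intro s hs
    have hs0 : s - 1 ≠ 0 := fun h => by
      have := congrArg Complex.re h
      simp at this
      linarith
    have hslit : 1 / (s - 1) ∈ Complex.slitPlane := by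
      left
      rw [one_div, Complex.inv_re]
      have : 0 < Complex.normSq (s - 1) := Complex.normSq_pos.2 hs0
      have : 0 < (s - 1).re := by simp; linarith
      positivity
    refine (hasDerivAt_primeClassSeries a hs).sub (HasDerivAt.const_mul _ ?_)
    have h1 : HasDerivAt (fun z : ℂ => 1 / (z - 1)) (-1 / (s - 1) ^ 2) s := by
      simpa [one_div] using ((hasDerivAt_id s).sub_const 1).fun_inv hs0
    convert! h1.clog hslit using 1
    field_simp
  · have hev := (Metric.tendsto_nhds.1 hcont) 1 one_pos
    filter_upwards [hev, self_mem_nhdsWithin] with s h1 hs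
    have h2 := ArithmeticFunction.vonMangoldt.eqOn_LFunctionResidueClassAux ha hs
    have h3 := hB s hs
    rw [dist_eq_norm] at h1
    have h4 := norm_sub_norm_le (ArithmeticFunction.vonMangoldt.LFunctionResidueClassAux a s)
      (ArithmeticFunction.vonMangoldt.LFunctionResidueClassAux a 1)
    have e : -LSeries (LSeries.logMul (primeIndicator a)) s -
        1 / (Nat.totient q : ℂ) * (-(1 / (s - 1)))
        = (LSeries (fun n => (ArithmeticFunction.vonMangoldt.residueClass a n : ℂ)) s
          - LSeries (LSeries.logMul (primeIndicator a)) s)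
          - ArithmeticFunction.vonMangoldt.LFunctionResidueClassAux a s := by
      rw [h2]
      ring
    rw [e]
    refine (norm_sub_le _ _).trans ?_
    linarith

end LimitExists

/-! ### Comparison of one class with all primes. -/

section Comparison

theorem tendsto_sum_primeClassSeries {q : ℕ} (a : ZMod q) {σ : ℝ} (hσ : 1 < σ) :
    Tendsto (fun N : ℕ => ∑ p ∈ Finset.range N with Nat.Prime p ∧ (p : ZMod q) = a,
      ((1 / (p : ℝ) ^ σ : ℝ) : ℂ)) atTop (𝓝 (primeClassSeries a σ)) := by
  have hs : Summable (fun n : ℕ => (primesInClass a).indicator (fun n : ℕ => 1 / (n : ℂ) ^ (σ : ℂ)) n) :=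
    (Complex.summable_one_div_nat_cpow.mpr (by simpa using hσ)).indicator _
  have h := hs.hasSum.tendsto_sum_nat
  rw [← tsum_subtype (primesInClass a) (fun n : ℕ => 1 / (n : ℂ) ^ (σ : ℂ))] at h
  refine h.congr fun N => ?_
  rw [Finset.sum_filter]
  refine Finset.sum_congr rfl fun p _ => ?_
  classical
  rw [Set.indicator_apply]
  refine if_congr Iff.rfl ?_ rfl
  push_cast
  rw [Complex.ofReal_cpow (Nat.cast_nonneg p)]
  simp

/-- Primes in a residue class are equidistributed beyond `exp (q^6)`, in a weak average sense. -/
theorem exists_norm_sum_prime_class_sub_le : ∃ K : ℝ, 0 < K ∧ ∀ (q : ℕ) [NeZero q] (a : ZMod q),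
    IsUnit a → ∀ σ : ℝ, 1 < σ → ∀ y : ℕ, 2 ≤ y → q < y → ∀ N : ℕ,
    ‖∑ p ∈ Finset.Ico y N with Nat.Prime p ∧ (p : ZMod q) = a, ((1 / (p : ℝ) ^ σ : ℝ) : ℂ)
      - 1 / (q.totient : ℂ) * ∑ p ∈ Finset.Ico y N with p.Prime, ((1 / (p : ℝ) ^ σ : ℝ) : ℂ)‖
      ≤ K * (q : ℝ) ^ 5 / Real.log y := by
  classical
  obtain ⟨K, hK0, hK⟩ := DirichletCharacter.exists_norm_sum_prime_le
  refine ⟨K, hK0, fun q _ a ha σ hσ y hy hqy N => ?_⟩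
  have hφ : (0 : ℝ) < q.totient := by exact_mod_cast Nat.totient_pos.2 (NeZero.pos q)
  have hφ' : (q.totient : ℂ) ≠ 0 := by exact_mod_cast hφ.ne'
  set P := (Finset.Ico y N).filter Nat.Prime with hP
  set w : ℕ → ℂ := fun p => ((1 / (p : ℝ) ^ σ : ℝ) : ℂ) with hw
  set B : ℝ := K * (q : ℝ) ^ 5 / Real.log y
  have hunit : ∀ p ∈ P, IsUnit (p : ZMod q) := by
    intro p hp
    obtain ⟨h1, h2⟩ := Finset.mem_filter.1 hp
    rw [ZMod.isUnit_iff_coprime, h2.coprime_iff_not_dvd]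
    intro h
    have h3 := Nat.le_of_dvd (NeZero.pos q) h
    have h4 := (Finset.mem_Ico.1 h1).1
    omega
  have hainv : IsUnit a⁻¹ := isUnit_of_dvd_one ⟨a, (ZMod.inv_mul_of_unit a ha).symm⟩
  have e1 : (q.totient : ℂ) * ∑ p ∈ Finset.Ico y N with Nat.Prime p ∧ (p : ZMod q) = a, w p
      = ∑ χ : DirichletCharacter ℂ q, χ a⁻¹ * ∑ p ∈ P, χ (p : ZMod q) * w p := by
    simp_rw [Finset.mul_sum]
    rw [Finset.sum_comm, ← Finset.filter_filter, Finset.sum_filter]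
    refine Finset.sum_congr rfl fun p _ => ?_
    simp_rw [← mul_assoc]
    rw [← Finset.sum_mul, DirichletCharacter.sum_char_inv_mul_char_eq ℂ ha]
    by_cases h : (p : ZMod q) = a
    · rw [if_pos h, if_pos h.symm]
    · rw [if_neg h, if_neg (Ne.symm h), zero_mul]
  have e2 : (1 : DirichletCharacter ℂ q) a⁻¹ * ∑ p ∈ P, (1 : DirichletCharacter ℂ q) (p : ZMod q) * w p
      = ∑ p ∈ P, w p := by
    rw [MulChar.one_apply hainv, one_mul]
    refine Finset.sum_congr rfl fun p hp => ?_
    rw [MulChar.one_apply (hunit p hp), one_mul]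
  -- As `p ≥ y > q` is prime to `q`, the principal character contributes exactly the sum over all
  -- primes.
  rw [Fintype.sum_eq_add_sum_compl 1, e2] at e1
  have e3 : ∑ p ∈ Finset.Ico y N with Nat.Prime p ∧ (p : ZMod q) = a, w p
      - 1 / (q.totient : ℂ) * ∑ p ∈ P, w p
      = 1 / (q.totient : ℂ) * ∑ χ ∈ ({1}ᶜ : Finset (DirichletCharacter ℂ q)),
        χ a⁻¹ * ∑ p ∈ P, χ (p : ZMod q) * w p := by
    rw [eq_sub_of_add_eq' e1.symm]
    field_simp
  rw [e3, norm_mul, norm_div, norm_one, Complex.norm_natCast, one_div, inv_mul_le_iff₀ hφ]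
  have hb : ∀ χ ∈ ({1}ᶜ : Finset (DirichletCharacter ℂ q)),
      ‖χ a⁻¹ * ∑ p ∈ P, χ (p : ZMod q) * w p‖ ≤ B := by
    intro χ hχ
    rw [norm_mul]
    refine (mul_le_of_le_one_left (norm_nonneg _) (χ.norm_le_one _)).trans ?_
    exact hK q χ (by simpa using hχ) σ hσ y hy N
  refine (norm_sum_le_of_le _ hb).trans ?_
  rw [Finset.sum_const, nsmul_eq_mul]
  have hB0 : 0 ≤ B := by
    have : 0 < Real.log y := Real.log_pos (by exact_mod_cast (by omega : 1 < y))
    positivity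
  refine mul_le_mul_of_nonneg_right ?_ hB0
  have hcard : Fintype.card (DirichletCharacter ℂ q) = q.totient := by
    rw [← Nat.card_eq_fintype_card]
    exact DirichletCharacter.card_eq_totient_of_hasEnoughRootsOfUnity ℂ q
  rw [← hcard]
  exact_mod_cast Finset.card_le_univ _

theorem tendsto_sum_rpow_nhdsGT_one (s : Finset ℕ) (hs : ∀ p ∈ s, p ≠ 0) :
    Tendsto (fun σ : ℝ => ∑ p ∈ s, ((1 / (p : ℝ) ^ σ : ℝ) : ℂ)) (𝓝[>] 1)
      (𝓝 (((∑ p ∈ s, 1 / (p : ℝ) : ℝ)) : ℂ)) := by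
  rw [Complex.ofReal_sum]
  refine tendsto_finsetSum _ fun p hp => ?_
  have hp0 : (0 : ℝ) < p := by exact_mod_cast Nat.pos_of_ne_zero (hs p hp)
  have h1 : Tendsto (fun σ : ℝ => 1 / (p : ℝ) ^ σ) (𝓝 1) (𝓝 (1 / (p : ℝ) ^ (1 : ℝ))) :=
    tendsto_const_nhds.div ((Real.continuous_const_rpow hp0.ne').tendsto 1) (by positivity)
  rw [Real.rpow_one] at h1
  exact (Complex.continuous_ofReal.tendsto _).comp (h1.mono_left nhdsWithin_le_nhds)

/-- Comparison of the limit constants of a residue class with those of all primes. -/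
theorem exists_norm_limit_sub_le : ∃ K : ℝ, 0 < K ∧ ∃ L₁ : ℂ, ∀ (q : ℕ) [NeZero q] (a : ZMod q),
    IsUnit a → ∀ L : ℂ,
    Tendsto (fun s : ℂ => primeClassSeries a s -
      1 / (Nat.totient q : ℂ) * Complex.log (1 / (s - 1))) (𝓝[{s : ℂ | 1 < s.re}] 1) (𝓝 L) →
    ∀ y : ℕ, 2 ≤ y → q < y →
    ‖L - ((∑ p ∈ Finset.range y with Nat.Prime p ∧ (p : ZMod q) = a, 1 / (p : ℝ) : ℝ) : ℂ)
      - 1 / (q.totient : ℂ) * (L₁ - ((∑ p ∈ Finset.range y with p.Prime, 1 / (p : ℝ) : ℝ) : ℂ))‖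
      ≤ K * (q : ℝ) ^ 5 / Real.log y := by
  classical
  obtain ⟨K, hK0, hK⟩ := exists_norm_sum_prime_class_sub_le
  obtain ⟨L₁, hL₁⟩ := exists_tendsto_primeClassSeries_sub (q := 1) (a := 0)
    (isUnit_of_subsingleton _)
  refine ⟨K, hK0, L₁, fun q _ a ha L hL y hy hqy => ?_⟩
  have hTa := tendsto_sum_rpow_nhdsGT_one
    ((Finset.range y).filter fun p => Nat.Prime p ∧ (p : ZMod q) = a)
    (fun p hp => (Finset.mem_filter.1 hp).2.1.ne_zero)
  have hT1 := tendsto_sum_rpow_nhdsGT_one ((Finset.range y).filter fun p => p.Prime)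
    (fun p hp => (Finset.mem_filter.1 hp).2.ne_zero)
  -- The logarithms cancel since `φ(1) = 1`, so for fixed `σ > 1` only sums over primes `p ≥ y`
  -- remain. Their bound is uniform in `σ` and survives `σ → 1`.
  have hlim := ((hL.comp tendsto_ofReal_nhdsGT_one).sub hTa).sub
    (((hL₁.comp tendsto_ofReal_nhdsGT_one).sub hT1).const_mul (1 / (q.totient : ℂ)))
  refine le_of_tendsto hlim.norm ?_
  filter_upwards [self_mem_nhdsWithin] with σ (hσ : 1 < σ)
  have hPa := tendsto_sum_primeClassSeries a hσ
  have hP1 := tendsto_sum_primeClassSeries (0 : ZMod 1) hσ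
  have hlim2 := (hPa.sub_const (∑ p ∈ Finset.range y with Nat.Prime p ∧ (p : ZMod q) = a,
    ((1 / (p : ℝ) ^ σ : ℝ) : ℂ))).sub ((hP1.sub_const (∑ p ∈ Finset.range y with p.Prime,
    ((1 / (p : ℝ) ^ σ : ℝ) : ℂ))).const_mul (1 / (q.totient : ℂ)))
  have hbound := le_of_tendsto hlim2.norm (by
    filter_upwards [eventually_ge_atTop y] with N hN
    have e1 : ∑ p ∈ Finset.range N with Nat.Prime p ∧ (p : ZMod q) = a, ((1 / (p : ℝ) ^ σ : ℝ) : ℂ)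
        - ∑ p ∈ Finset.range y with Nat.Prime p ∧ (p : ZMod q) = a, ((1 / (p : ℝ) ^ σ : ℝ) : ℂ)
        = ∑ p ∈ Finset.Ico y N with Nat.Prime p ∧ (p : ZMod q) = a, ((1 / (p : ℝ) ^ σ : ℝ) : ℂ) := by
      simp only [Finset.sum_filter]
      rw [Finset.sum_Ico_eq_sub _ hN]
    have e2 : ∑ p ∈ Finset.range N with Nat.Prime p ∧ (p : ZMod 1) = 0, ((1 / (p : ℝ) ^ σ : ℝ) : ℂ)
        - ∑ p ∈ Finset.range y with p.Prime, ((1 / (p : ℝ) ^ σ : ℝ) : ℂ)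
        = ∑ p ∈ Finset.Ico y N with p.Prime, ((1 / (p : ℝ) ^ σ : ℝ) : ℂ) := by
      have h0 : ∀ p : ℕ, (p : ZMod 1) = 0 := fun p => Subsingleton.elim _ _
      simp only [h0, and_true, Finset.sum_filter]
      rw [Finset.sum_Ico_eq_sub _ hN]
    rw [e1, e2]
    exact hK q a ha σ hσ y hy hqy N)
  refine le_of_eq_of_le ?_ hbound
  congr 1
  simp only [Function.comp_apply, Nat.totient_one, Nat.cast_one]
  ring

end Comparison

/-! ### Isolating the least prime, and conclusion. -/

/-- Any other prime of the class differs from the least by a positive multiple of `q`, so exceeds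
`q`. If the least prime is not below `y`, the sum is empty and its reciprocal is at most `1/q`. -/
theorem abs_sum_inv_sub_leastPrime_le {q : ℕ} (hq : 1 ≤ q) {a : ZMod q} (ha : IsUnit a) {y : ℕ}
    (hqy : q ≤ y) :
    |∑ p ∈ Finset.range y with Nat.Prime p ∧ (p : ZMod q) = a, 1 / (p : ℝ)
      - 1 / (leastPrimeInClass a : ℝ)|
      ≤ (∑ p ∈ Finset.range y with p.Prime ∧ q < p ∧ p ≡ a.val [MOD q], 1 / (p : ℝ)) + 1 / q := by
  have : NeZero q := ⟨by omega⟩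
  have hq' : (0 : ℝ) < q := by exact_mod_cast hq
  obtain ⟨⟨hp0, hp0a⟩, hmin⟩ := isLeast_leastPrimeInClass hq ha
  set p0 := leastPrimeInClass a
  have hrhs : 0 ≤ ∑ p ∈ Finset.range y with p.Prime ∧ q < p ∧ p ≡ a.val [MOD q], 1 / (p : ℝ) :=
    Finset.sum_nonneg fun _ _ => by positivity
  rcases lt_or_ge p0 y with h | h
  · have hmem : p0 ∈ (Finset.range y).filter fun p => Nat.Prime p ∧ (p : ZMod q) = a :=
      Finset.mem_filter.2 ⟨Finset.mem_range.2 h, hp0, hp0a⟩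
    rw [← Finset.add_sum_erase _ _ hmem, add_sub_cancel_left,
      abs_of_nonneg (Finset.sum_nonneg fun _ _ => by positivity)]
    refine le_add_of_le_of_nonneg ?_ (by positivity)
    refine Finset.sum_le_sum_of_subset_of_nonneg ?_ fun _ _ _ => by positivity
    intro p hp
    obtain ⟨hne, hp⟩ := Finset.mem_erase.1 hp
    obtain ⟨hpy, hpp, hpa⟩ := Finset.mem_filter.1 hp
    have hle : p0 ≤ p := hmin ⟨hpp, hpa⟩
    have hdvd : q ∣ p - p0 :=
      (Nat.modEq_iff_dvd' hle).1 ((ZMod.natCast_eq_natCast_iff _ _ _).1 (hp0a.trans hpa.symm))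
    have hqle := Nat.le_of_dvd (by omega) hdvd
    have hpos := hp0.pos
    refine Finset.mem_filter.2 ⟨hpy, hpp, by omega, ?_⟩
    rw [← ZMod.natCast_eq_natCast_iff, ZMod.natCast_zmod_val]
    exact hpa
  · rw [Finset.filter_false_of_mem, Finset.sum_empty, zero_sub, abs_neg, abs_of_nonneg (by positivity)]
    · have h1 : 1 / (p0 : ℝ) ≤ 1 / q :=
        one_div_le_one_div_of_le hq' (by exact_mod_cast hqy.trans h)
      linarith
    · rintro p hp ⟨hpp, hpa⟩
      have hle : p0 ≤ p := hmin ⟨hpp, hpa⟩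
      have := Finset.mem_range.1 hp
      omega

theorem lemma8p1 :
    ∃ C : ℝ, 0 < C ∧ ∀ (q : ℕ) (a : ZMod q), 1 ≤ q → IsUnit a →
      ∃ L : ℂ,
        Tendsto
          (fun s : ℂ => primeClassSeries a s -
            1 / (Nat.totient q : ℂ) * Complex.log (1 / (s - 1)))
          (𝓝[{s : ℂ | 1 < s.re}] 1) (𝓝 L) ∧
        ‖L - 1 / (leastPrimeInClass a : ℂ)‖ ≤
          C * (Real.log (2 * (q : ℝ)) / (Nat.totient q : ℝ)) := by
  classical
  obtain ⟨K, hK0, L₁, hK⟩ := exists_norm_limit_sub_le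
  obtain ⟨C, hC0, hC⟩ := exists_sum_inv_primes_le
  -- The doubled terms absorb constants through `1 ≤ 2 log 2q`. The class and the full set of primes
  -- cost `8C` each, where `8 = 1 + 7` and `log (J + 1) ≤ 7 log 2q`.
  refine ⟨2 * K + 2 * ‖L₁‖ + 16 * C + 2, by positivity, fun q a hq ha => ?_⟩
  have : NeZero q := ⟨by omega⟩
  obtain ⟨L, hL⟩ := exists_tendsto_primeClassSeries_sub ha
  refine ⟨L, hL, ?_⟩
  have hq1 : (1 : ℝ) ≤ q := by exact_mod_cast hq
  have hφ : (0 : ℝ) < q.totient := by exact_mod_cast Nat.totient_pos.2 hq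
  have hφq : (q.totient : ℝ) ≤ q := by exact_mod_cast Nat.totient_le q
  have hlog2 := Real.log_two_gt_d9
  set Λ := Real.log (2 * q) with hΛ
  have hΛ2 : Real.log 2 ≤ Λ := Real.log_le_log two_pos (by linarith)
  -- The exponent `6` makes `log (2^J)` beat the loss `q^5` by a factor of order `q`, while `log J`
  -- stays `O(log 2q)`.
  set J := (2 * q) ^ 6 with hJ
  have hJlt : J < 2 ^ J := Nat.lt_two_pow_self
  have hqJ : 2 * q ≤ J := Nat.le_self_pow (by norm_num) _
  have hJ1 : (1 : ℝ) ≤ J := by exact_mod_cast (by omega : 1 ≤ J)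
  have hlogJ : Real.log ((J : ℝ) + 1) ≤ 7 * Λ := by
    calc Real.log ((J : ℝ) + 1) ≤ Real.log (2 * J) :=
          Real.log_le_log (by linarith) (by linarith)
      _ = Real.log 2 + 6 * Λ := by
          rw [Real.log_mul (by norm_num) (by linarith), hJ]
          push_cast
          rw [Real.log_pow]
          norm_num [hΛ]
      _ ≤ 7 * Λ := by linarith
  have hmain := hK q a ha L hL (2 ^ J) (by omega) (by omega)
  have herr : K * (q : ℝ) ^ 5 / Real.log ((2 ^ J : ℕ) : ℝ) ≤ K / q := by
    push_cast
    rw [Real.log_pow, div_le_div_iff₀ (by positivity) (by linarith), mul_assoc]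
    refine mul_le_mul_of_nonneg_left ?_ hK0.le
    rw [hJ]
    push_cast
    have : 0 ≤ (q : ℝ) ^ 6 := by positivity
    nlinarith
  have hA := abs_sum_inv_sub_leastPrime_le hq ha (y := 2 ^ J) (by omega)
  have hA2 := hC q hq a.val J
  have hall : ∑ p ∈ Finset.range (2 ^ J) with p.Prime, 1 / (p : ℝ) ≤ 8 * C * Λ := by
    have h1 := hC 1 one_pos 0 J
    have h2 : (Finset.range (2 ^ J)).filter (fun p => p.Prime ∧ 1 < p ∧ p ≡ 0 [MOD 1])
        = (Finset.range (2 ^ J)).filter Nat.Prime :=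
      Finset.filter_congr fun p _ => ⟨fun h => h.1, fun h => ⟨h, h.one_lt, Nat.modEq_one⟩⟩
    rw [h2] at h1
    simp only [Nat.cast_one, mul_one, Nat.totient_one, div_one] at h1
    refine h1.trans ?_
    nlinarith
  have hall0 : 0 ≤ ∑ p ∈ Finset.range (2 ^ J) with p.Prime, 1 / (p : ℝ) :=
    Finset.sum_nonneg fun _ _ => by positivity
  set Sa := ∑ p ∈ Finset.range (2 ^ J) with Nat.Prime p ∧ (p : ZMod q) = a, 1 / (p : ℝ)
  set S1 := ∑ p ∈ Finset.range (2 ^ J) with p.Prime, 1 / (p : ℝ)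
  have hinv : 1 / (q : ℝ) ≤ 1 / q.totient := one_div_le_one_div_of_le hφ hφq
  have e : L - 1 / (leastPrimeInClass a : ℂ) = (L - (Sa : ℂ) - 1 / (q.totient : ℂ) * (L₁ - (S1 : ℂ)))
      + 1 / (q.totient : ℂ) * (L₁ - (S1 : ℂ))
      + ((Sa - 1 / (leastPrimeInClass a : ℝ) : ℝ) : ℂ) := by
    push_cast
    ring
  have h2 : ‖1 / (q.totient : ℂ) * (L₁ - (S1 : ℂ))‖ ≤ (‖L₁‖ + 8 * C * Λ) / q.totient := by
    rw [norm_mul, norm_div, norm_one, Complex.norm_natCast, one_div_mul_eq_div]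
    gcongr
    refine (norm_sub_le _ _).trans ?_
    rw [Complex.norm_of_nonneg hall0]
    gcongr
  have h3 : ‖((Sa - 1 / (leastPrimeInClass a : ℝ) : ℝ) : ℂ)‖ ≤ 8 * C * Λ / q.totient + 1 / q.totient := by
    rw [Complex.norm_real, Real.norm_eq_abs]
    refine hA.trans (add_le_add (hA2.trans ?_) hinv)
    refine div_le_div_of_nonneg_right ?_ hφ.le
    nlinarith
  have h1 : K / (q : ℝ) ≤ K / q.totient := div_le_div_of_nonneg_left hK0.le hφ hφq
  rw [e]
  refine (norm_add₃_le).trans ?_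
  have h4 : K / q.totient + (‖L₁‖ + 8 * C * Λ) / q.totient
      + (8 * C * Λ / q.totient + 1 / q.totient)
      = (K + ‖L₁‖ + 16 * C * Λ + 1) / q.totient := by ring
  have h5 : (K + ‖L₁‖ + 16 * C * Λ + 1) / q.totient
      ≤ (2 * K + 2 * ‖L₁‖ + 16 * C + 2) * (Λ / q.totient) := by
    rw [mul_div_assoc']
    gcongr
    have := norm_nonneg L₁
    nlinarith
  linarith
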